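/- For an integer $b\ge 2$ and an integer $0\le x<b^4$, written with exactly four base-$b$ digits (leading zeros allowed), let $K_b(x)=D-A$, where $D$ and $A$ are the integers whose four base-$b$ digits are those of $x$ arranged in descending and in ascending order, respectively. For $b\in\{2,4\}\cup\{5,10,15,20,\dots\}$ consider those $x$ with $0\le x<b^4$ for which some iterate $K_b^t(x)$, $t\ge 0$, is a nonzero fixed point of $K_b$; the least such $t$ is the distance of $x$ from a nonzero fixed point. Let $M_b$ be the largest of these finite distances. Then $M_b$ exists and: (i) $M_2=1$, $M_4=3$, $M_5=4$, $M_{10}=7$ and $M_{20}=10$. (ii) If $b=5m\cdot 2^n$ with $m>1$ odd and $n\ge 0$, then $M_b=n+2$. (iii) If $b=5\cdot 2^n$ with $n\ge 3$, then \[ M_b=\begin{cases}4n+6 & n\equiv 0 \pmod 4,\\ 3n+5 & n\equiv 1 \pmod 4,\\ 3n+5 & n\equiv 2 \pmod 4,\\ 5n+6 & n\equiv 3 \pmod 4.\end{cases} \] -/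

import Mathlib

/-- The four base-`b` digits of `x` (leading zeros included), least significant first. -/
def fourDigits (b x : ℕ) : List ℕ :=
  [x % b, x / b % b, x / b ^ 2 % b, x / b ^ 3 % b]

/-- The four-digit Kaprekar map in base `b`: the digits of `x` in descending order, read as a
base-`b` numeral, minus the digits of `x` in ascending order, read as a base-`b` numeral.
`Nat.ofDigits` puts the least significant digit first, so a list sorted by `≤` is the numeral
with descending digits. The minuend is never smaller than the subtrahend, so the subtraction
does not truncate. -/
def kaprekar (b x : ℕ) : ℕ :=
  Nat.ofDigits b ((fourDigits b x).insertionSort (· ≤ ·)) -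
    Nat.ofDigits b ((fourDigits b x).insertionSort (· ≥ ·))

/-- `y` is a nonzero fixed point of the Kaprekar map in base `b`. -/
def IsNonzeroFixedPoint (b y : ℕ) : Prop :=
  y ≠ 0 ∧ Function.IsFixedPt (kaprekar b) y

/-- `x` is at finite distance `t` from a nonzero fixed point: `t` is the least number of
iterations of the Kaprekar map in base `b` that takes `x` to a nonzero fixed point. -/
def HasDistance (b x t : ℕ) : Prop :=
  IsLeast {s : ℕ | IsNonzeroFixedPoint b ((kaprekar b)^[s] x)} t

/-- `M` is the largest finite distance of a four-digit base-`b` number `x`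
(that is, `0 ≤ x < b ^ 4`) from a nonzero fixed point. -/
def IsMaxDistance (b M : ℕ) : Prop :=
  IsGreatest {t : ℕ | ∃ x < b ^ 4, HasDistance b x t} M

/-! One Kaprekar step depends only on the outer and inner differences `x`, `y` of the sorted digits.
If `x ≥ y > 0`, the new digits are `x, y - 1, b - 1 - y, b - x`: two pairs symmetric about `b / 2`
and `b / 2 - 1`, of widths `fold b x` and `fold b y`. These widths are the new differences unless
they agree; then the offset of the centres turns the common width `u` into `u + 1` and `|u - 1|` (a
collision). A pair `s(w, 0)` goes to `s(b - w, w - 1)`. Since `pairValue` is injective on pairs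
below `b`, a number's distance is one more than its pair's, once at least one step is needed. In
base `5 * k` the target is `s(3 * k, k)`, whose entries `fold` exchanges.

Modulo `2 * b` and up to sign, `fold` is an affine doubling map (`fold_iterate_succ_dvd`). In base
`5 * 2 ^ n` the value after `n + 1` folds is therefore fixed by the residue modulo `5` up to sign:
classes `0`, `±1`, `±2` go to `5`, `3`, `1` times `2 ^ n`.

An odd factor `m > 1` of `k` must divide both entries of any pair that reaches the target. This
excludes zeros and collisions, and leaves at most `n + 1` independent folds.

In base `5 * 2 ^ n`, different nonzero classes reach the target in `n + 1` steps, equal classes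
collide, and multiples of `5` vanish or collide. With `k = 2 ^ n`, everything reduces to the three
pairs `s(k + 1, k - 1)`, `s(b - k, k - 1)` and `s(3 * k, 2 * k - 1)`. Their fate, arrival or a
cycle, depends on `k` modulo `5`, hence on `n` modulo `4`; explicit orbits show the resulting bounds
are sharp. -/

/-- `|b - 2 * x|`. -/
def fold (b x : ℕ) : ℕ := (b - 2 * x) + (2 * x - b)

/-- The effect of the Kaprekar map on the differences of opposite sorted digits. -/
def stepPair (b x y : ℕ) : Sym2 ℕ :=
  if x = 0 then (if y = 0 then s(0, 0) else s(b - y, y - 1))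
  else if y = 0 then s(b - x, x - 1)
  else if fold b x = fold b y then s(fold b x + 1, (fold b x - 1) + (1 - fold b x))
  else s(fold b x, fold b y)

theorem stepPair_comm (b x y : ℕ) : stepPair b x y = stepPair b y x := by
  unfold stepPair
  split_ifs <;> simp_all [Sym2.eq_swap]

/-- The Kaprekar map on unordered pairs of differences of opposite sorted digits. -/
def step (b : ℕ) : Sym2 ℕ → Sym2 ℕ := Sym2.lift ⟨stepPair b, stepPair_comm b⟩

theorem step_mk (b x y : ℕ) : step b s(x, y) = stepPair b x y := rfl

/-- The value of the Kaprekar map at a numeral with the given digit differences. -/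
def pairValue (b : ℕ) : Sym2 ℕ → ℕ :=
  Sym2.lift ⟨fun x y => max x y * (b ^ 3 - 1) + min x y * (b ^ 2 - b), fun x y => by
    simp only [max_comm, min_comm]⟩

theorem pairValue_mk (b x y : ℕ) :
    pairValue b s(x, y) = max x y * (b ^ 3 - 1) + min x y * (b ^ 2 - b) := rfl

/-- The outer and the inner difference of a list of four numbers. -/
def outerInner : List ℕ → Sym2 ℕ
  | [p, q, r, t] => s(t - p, r - q)
  | _ => s(0, 0)

/-- The outer and the inner difference of the sorted base-`b` digits. -/
def digitDiffs (b x : ℕ) : Sym2 ℕ :=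
  outerInner ((fourDigits b x).insertionSort (· ≤ ·))

/-- All entries of the pair are smaller than `b`. -/
def Below (b : ℕ) (p : Sym2 ℕ) : Prop := ∀ z ∈ p, z < b

theorem below_mk {b x y : ℕ} : Below b s(x, y) ↔ x < b ∧ y < b := by
  simp [Below]

theorem exists_mk_ordered (p : Sym2 ℕ) : ∃ x y, y ≤ x ∧ p = s(x, y) := by
  induction p with | _ x y
  rcases le_total y x with h | h
  · exact ⟨x, y, h, rfl⟩
  · exact ⟨y, x, h, Sym2.eq_swap⟩

/-! ### Reduction from numbers to pairs of digit differences -/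

theorem exists_sorted (b x : ℕ) (hb : 0 < b) : ∃ p q r t : ℕ, p ≤ q ∧ q ≤ r ∧ r ≤ t ∧ t < b ∧
    (fourDigits b x).insertionSort (· ≤ ·) = [p, q, r, t] ∧
    (fourDigits b x).insertionSort (· ≥ ·) = [t, r, q, p] := by
  have hperm := List.perm_insertionSort (· ≤ ·) (fourDigits b x)
  have hperm' := List.perm_insertionSort (· ≥ ·) (fourDigits b x)
  have hs := List.pairwise_insertionSort (· ≤ ·) (fourDigits b x)
  have hs' := List.pairwise_insertionSort (· ≥ ·) (fourDigits b x)
  have hlen := hperm.length_eq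
  have hlt : ∀ z ∈ fourDigits b x, z < b := by
    intro z hz
    simp only [fourDigits, List.mem_cons, List.not_mem_nil, or_false] at hz
    rcases hz with rfl | rfl | rfl | rfl <;> exact Nat.mod_lt _ hb
  obtain ⟨p, q, r, t, h⟩ := List.length_eq_four.mp hlen
  have hrev : (fourDigits b x).insertionSort (· ≥ ·) = [t, r, q, p] := by
    refine List.Perm.eq_of_pairwise' hs' (r := (· ≥ ·)) ?_ ?_
    · rw [h] at hs
      have := List.pairwise_reverse.mpr hs
      simpa using this
    · refine hperm'.trans (hperm.symm.trans ?_)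
      rw [h]
      exact (List.reverse_perm [p, q, r, t]).symm
  rw [h] at hs hperm
  simp only [List.pairwise_cons, List.mem_cons, List.not_mem_nil, or_false] at hs
  refine ⟨p, q, r, t, hs.1 _ (by simp), hs.2.1 _ (by simp), hs.2.2.1 _ (by simp),
    hlt _ (hperm.subset (by simp)), h, hrev⟩

theorem kaprekar_eq (b x : ℕ) (hb : 0 < b) : kaprekar b x = pairValue b (digitDiffs b x) := by
  obtain ⟨p, q, r, t, h1, h2, h3, -, h, h'⟩ := exists_sorted b x hb
  unfold kaprekar digitDiffs
  rw [h, h']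
  simp only [outerInner, pairValue_mk, Nat.ofDigits_cons, Nat.ofDigits_nil]
  rw [max_eq_left (by omega), min_eq_right (by omega)]
  obtain ⟨e, rfl⟩ := Nat.exists_eq_add_of_le h1
  obtain ⟨f, rfl⟩ := Nat.exists_eq_add_of_le h2
  obtain ⟨g, rfl⟩ := Nat.exists_eq_add_of_le h3
  obtain ⟨c, rfl⟩ := Nat.exists_eq_add_of_le hb
  have e1 : (1 + c) ^ 3 - 1 = c ^ 3 + 3 * c ^ 2 + 3 * c :=
    Nat.sub_eq_of_eq_add (by ring)
  have e2 : (1 + c) ^ 2 - (1 + c) = c ^ 2 + c := Nat.sub_eq_of_eq_add (by ring)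
  rw [show p + e + f + g - p = e + f + g by omega, show p + e + f - (p + e) = f by omega,
    e1, e2]
  apply Nat.sub_eq_of_eq_add
  push_cast
  ring

theorem digitDiffs_below (b x : ℕ) (hb : 0 < b) : Below b (digitDiffs b x) := by
  obtain ⟨p, q, r, t, h1, h2, h3, h4, h, -⟩ := exists_sorted b x hb
  unfold digitDiffs
  rw [h]
  simp only [outerInner, below_mk]
  omega

theorem fourDigits_eq {b p q r t : ℕ} (hp : p < b) (hq : q < b) (hr : r < b) (ht : t < b) :
    fourDigits b (p + b * q + b ^ 2 * r + b ^ 3 * t) = [p, q, r, t] := by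
  have hb : 0 < b := by omega
  have e1 : (p + b * q + b ^ 2 * r + b ^ 3 * t) / b = q + b * r + b ^ 2 * t := by
    rw [show p + b * q + b ^ 2 * r + b ^ 3 * t = p + b * (q + b * r + b ^ 2 * t) by ring,
      Nat.add_mul_div_left _ _ hb, Nat.div_eq_of_lt hp, zero_add]
  have e2 : (q + b * r + b ^ 2 * t) / b = r + b * t := by
    rw [show q + b * r + b ^ 2 * t = q + b * (r + b * t) by ring,
      Nat.add_mul_div_left _ _ hb, Nat.div_eq_of_lt hq, zero_add]
  have e3 : (r + b * t) / b = t := by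
    rw [Nat.add_mul_div_left _ _ hb, Nat.div_eq_of_lt hr, zero_add]
  unfold fourDigits
  rw [show b ^ 3 = b * b * b by ring, show b ^ 2 = b * b by ring, ← Nat.div_div_eq_div_mul,
    ← Nat.div_div_eq_div_mul, ← Nat.div_div_eq_div_mul, show b * b * b = b ^ 3 by ring,
    show b * b = b ^ 2 by ring, e1, e2, e3, Nat.mod_eq_of_lt ht]
  rw [show p + b * q + b ^ 2 * r + b ^ 3 * t = p + b * (q + b * r + b ^ 2 * t) by ring,
    Nat.add_mul_mod_self_left, Nat.mod_eq_of_lt hp,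
    show q + b * r + b ^ 2 * t = q + b * (r + b * t) by ring,
    Nat.add_mul_mod_self_left, Nat.mod_eq_of_lt hq, Nat.add_mul_mod_self_left,
    Nat.mod_eq_of_lt hr]

theorem pairValue_zero_right {b w : ℕ} (hw : 0 < w) (hwb : w < b) :
    pairValue b s(w, 0) = (b - w) + b * (b - 1) + b ^ 2 * (b - 1) + b ^ 3 * (w - 1) := by
  obtain ⟨c, rfl⟩ := Nat.exists_eq_add_of_lt hwb
  obtain ⟨v, rfl⟩ := Nat.exists_eq_add_of_lt hw
  rw [pairValue_mk, max_eq_left (by omega), min_eq_right (by omega)]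
  have e1 : (0 + v + 1 + c + 1) ^ 3 - 1 + 1 = (v + c + 2) ^ 3 := by
    rw [Nat.sub_add_cancel (Nat.one_le_pow _ _ (by omega))]; ring
  rw [show 0 + v + 1 + c + 1 - (0 + v + 1) = c + 1 by omega,
    show 0 + v + 1 + c + 1 - 1 = v + c + 1 by omega, show 0 + v + 1 - 1 = v by omega]
  zify at e1 ⊢
  linear_combination ((v : ℤ) + 1) * e1

theorem pairValue_of_pos {b x y : ℕ} (hy : 0 < y) (hyx : y ≤ x) (hx : x < b) :
    pairValue b s(x, y) = (b - x) + b * (b - 1 - y) + b ^ 2 * (y - 1) + b ^ 3 * x := by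
  obtain ⟨v, rfl⟩ := Nat.exists_eq_add_of_lt hy
  obtain ⟨d, rfl⟩ := Nat.exists_eq_add_of_le hyx
  obtain ⟨c, rfl⟩ := Nat.exists_eq_add_of_lt hx
  rw [pairValue_mk, max_eq_left (by omega), min_eq_right (by omega)]
  have e1 : (0 + v + 1 + d + c + 1) ^ 3 - 1 + 1 = (v + d + c + 2) ^ 3 := by
    rw [Nat.sub_add_cancel (Nat.one_le_pow _ _ (by omega))]; ring
  have e2 : (0 + v + 1 + d + c + 1) ^ 2 - (0 + v + 1 + d + c + 1) + (v + d + c + 2)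
      = (v + d + c + 2) ^ 2 := by
    rw [show v + d + c + 2 = 0 + v + 1 + d + c + 1 by ring]
    exact Nat.sub_add_cancel (Nat.le_self_pow (by omega) _)
  rw [show 0 + v + 1 + d + c + 1 - (0 + v + 1 + d) = c + 1 by omega,
    show 0 + v + 1 + d + c + 1 - 1 - (0 + v + 1) = d + c by omega,
    show 0 + v + 1 - 1 = v by omega]
  zify at e1 e2 ⊢
  linear_combination ((v : ℤ) + 1 + d) * e1 + ((v : ℤ) + 1) * e2

/-- Compares `p` with `t` and `q` with `r` first, because these are the two symmetric digit pairs of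
a Kaprekar value. The inner difference is the absolute difference of the two middle candidates,
written with truncated subtractions. -/
theorem outerInner_insertionSort (p q r t : ℕ) :
    outerInner ([p, q, r, t].insertionSort (· ≤ ·)) =
      s(max (max p t) (max q r) - min (min p t) (min q r),
        (max (min p t) (min q r) - min (max p t) (max q r)) +
          (min (max p t) (max q r) - max (min p t) (min q r))) := by
  simp only [List.insertionSort, List.foldr, List.orderedInsert]
  split_ifs <;> simp only [List.orderedInsert] <;> split_ifs <;>
    simp only [List.orderedInsert] <;> split_ifs <;>
    simp only [outerInner] <;> congr 2 <;> omega

theorem digitDiffs_pairValue_of_le {b x y : ℕ} (hyx : y ≤ x) (hx : x < b) :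
    digitDiffs b (pairValue b s(x, y)) = step b s(x, y) := by
  unfold digitDiffs
  rw [step_mk]
  rcases Nat.eq_zero_or_pos y with rfl | hy
  · rcases Nat.eq_zero_or_pos x with rfl | hx0
    · simp [pairValue_mk, fourDigits, outerInner, stepPair]
    · rw [pairValue_zero_right hx0 hx, fourDigits_eq (by omega) (by omega) (by omega) (by omega),
        stepPair, if_neg hx0.ne', if_pos rfl, outerInner_insertionSort, Sym2.eq_iff]
      omega
  · rw [pairValue_of_pos hy hyx hx, fourDigits_eq (by omega) (by omega) (by omega) (by omega),
      stepPair, if_neg (by omega), if_neg hy.ne', outerInner_insertionSort]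
    -- Doubling avoids halving `b`: the pairs have centres `b / 2` and `b / 2 - 1`, so the wider
    -- pair encloses the other unless the widths agree.
    have h1 : 2 * max (b - x) x = b + fold b x := by unfold fold; omega
    have h2 : 2 * min (b - x) x + fold b x = b := by unfold fold; omega
    have h3 : 2 * max (b - 1 - y) (y - 1) + 2 = b + fold b y := by unfold fold; omega
    have h4 : 2 * min (b - 1 - y) (y - 1) + 2 + fold b y = b := by unfold fold; omega
    generalize max (b - x) x = M₁ at *
    generalize min (b - x) x = m₁ at *
    generalize max (b - 1 - y) (y - 1) = M₂ at *
    generalize min (b - 1 - y) (y - 1) = m₂ at *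
    generalize fold b x = u at *
    generalize fold b y = v at *
    rcases lt_trichotomy u v with h | h | h
    · rw [if_neg h.ne, Sym2.eq_iff, max_eq_right (show M₁ ≤ M₂ by omega),
        min_eq_right (show m₂ ≤ m₁ by omega), max_eq_left (show m₂ ≤ m₁ by omega),
        min_eq_left (show M₁ ≤ M₂ by omega)]
      omega
    · rw [if_pos h, Sym2.eq_iff, max_eq_left (show M₂ ≤ M₁ by omega),
        min_eq_right (show m₂ ≤ m₁ by omega), max_eq_left (show m₂ ≤ m₁ by omega),
        min_eq_right (show M₂ ≤ M₁ by omega)]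
      omega
    · rw [if_neg h.ne', Sym2.eq_iff, max_eq_left (show M₂ ≤ M₁ by omega),
        min_eq_left (show m₁ ≤ m₂ by omega), max_eq_right (show m₁ ≤ m₂ by omega),
        min_eq_right (show M₂ ≤ M₁ by omega)]
      omega

theorem digitDiffs_pairValue {b : ℕ} {p : Sym2 ℕ} (hp : Below b p) :
    digitDiffs b (pairValue b p) = step b p := by
  obtain ⟨x, y, hyx, rfl⟩ := exists_mk_ordered p
  exact digitDiffs_pairValue_of_le hyx (below_mk.mp hp).1

/-- Two zero digits leave the other two as differences, so every pair below `b` is realised by a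
number. -/
theorem digitDiffs_add_mul {b x y : ℕ} (hx : x < b) (hy : y < b) :
    digitDiffs b (x + b * y) = s(x, y) := by
  have h : fourDigits b (x + b * y) = [x, y, 0, 0] := by
    simpa using fourDigits_eq hx hy (show 0 < b by omega) (show 0 < b by omega)
  unfold digitDiffs
  rw [h]
  rw [outerInner_insertionSort, Sym2.eq_iff]
  omega

/-- The lower term is at most `(b - 1) * (b ^ 2 - b)`, less than one unit `b ^ 3 - 1` of the leading
term. For `b = 1` both weights vanish. -/
theorem pairValue_lt_of_lt {b x y x' y' : ℕ} (hyb : y < b) (h : x < x') :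
    x * (b ^ 3 - 1) + y * (b ^ 2 - b) < x' * (b ^ 3 - 1) + y' * (b ^ 2 - b) ∨ b = 1 := by
  rw [or_iff_not_imp_right]
  intro hb1
  obtain ⟨c, rfl⟩ : ∃ c, b = c + 2 := ⟨b - 2, by omega⟩
  have e1 : (c + 2) ^ 3 - 1 = c ^ 3 + 6 * c ^ 2 + 12 * c + 7 := Nat.sub_eq_of_eq_add (by ring)
  have e2 : (c + 2) ^ 2 - (c + 2) = c ^ 2 + 3 * c + 2 := Nat.sub_eq_of_eq_add (by ring)
  rw [e1, e2]
  have h1 := Nat.mul_le_mul_right (c ^ 3 + 6 * c ^ 2 + 12 * c + 7) (Nat.succ_le_of_lt h)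
  have h2 := Nat.mul_le_mul_right (c ^ 2 + 3 * c + 2) (Nat.le_of_lt_succ hyb)
  have h3 := Nat.zero_le (y' * (c ^ 2 + 3 * c + 2))
  rw [Nat.succ_mul] at h1
  nlinarith

theorem pairValue_inj_of_le {b x y x' y' : ℕ} (hx : x < b) (hx' : x' < b) (hyx : y ≤ x)
    (hyx' : y' ≤ x') (h : pairValue b s(x, y) = pairValue b s(x', y')) : x = x' ∧ y = y' := by
  rw [pairValue_mk, pairValue_mk, max_eq_left hyx, max_eq_left hyx', min_eq_right hyx,
    min_eq_right hyx'] at h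
  by_cases hb : b = 1
  · omega
  rcases lt_trichotomy x x' with hlt | rfl | hlt
  · have := pairValue_lt_of_lt (y' := y') (show y < b by omega) hlt
    omega
  · refine ⟨rfl, ?_⟩
    have hpos : 0 < b ^ 2 - b := by
      obtain ⟨c, rfl⟩ : ∃ c, b = c + 2 := ⟨b - 2, by omega⟩
      rw [Nat.sub_eq_of_eq_add (show (c + 2) ^ 2 = c ^ 2 + 3 * c + 2 + (c + 2) by ring)]
      omega
    exact Nat.eq_of_mul_eq_mul_right hpos (Nat.add_left_cancel h)
  · have := pairValue_lt_of_lt (y' := y) (show y' < b by omega) hlt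
    omega

theorem pairValue_inj {b : ℕ} {p q : Sym2 ℕ} (hp : Below b p) (hq : Below b q)
    (h : pairValue b p = pairValue b q) : p = q := by
  obtain ⟨x, y, hyx, rfl⟩ := exists_mk_ordered p
  obtain ⟨x', y', hyx', rfl⟩ := exists_mk_ordered q
  rw [below_mk] at hp hq
  obtain ⟨rfl, rfl⟩ := pairValue_inj_of_le hp.1 hq.1 hyx hyx' h
  rfl

theorem step_below {b : ℕ} {p : Sym2 ℕ} (hp : Below b p) : Below b (step b p) := by
  rw [← digitDiffs_pairValue hp]
  have : 0 < b := by
    induction p with | _ x y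
    rw [below_mk] at hp
    omega
  exact digitDiffs_below _ _ this

theorem step_iterate_below {b : ℕ} {p : Sym2 ℕ} (hp : Below b p) (t : ℕ) :
    Below b ((step b)^[t] p) := by
  induction t with
  | zero => exact hp
  | succ t ih => rw [Function.iterate_succ_apply']; exact step_below ih

theorem kaprekar_iterate_succ {b : ℕ} (hb : 0 < b) (x t : ℕ) :
    (kaprekar b)^[t + 1] x = pairValue b ((step b)^[t] (digitDiffs b x)) := by
  induction t with
  | zero => exact kaprekar_eq b x hb
  | succ t ih =>
    rw [Function.iterate_succ_apply', ih, kaprekar_eq _ _ hb, digitDiffs_pairValue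
      (step_iterate_below (digitDiffs_below b x hb) t), ← Function.iterate_succ_apply' (step b)]

theorem isNonzeroFixedPoint_pairValue {b : ℕ} {p : Sym2 ℕ} (hb : 0 < b) (hp : Below b p) :
    IsNonzeroFixedPoint b (pairValue b p) ↔ p ≠ s(0, 0) ∧ step b p = p := by
  have h0 : pairValue b s(0, 0) = 0 := by simp [pairValue_mk]
  unfold IsNonzeroFixedPoint Function.IsFixedPt
  rw [kaprekar_eq _ _ hb, digitDiffs_pairValue hp]
  constructor
  · rintro ⟨h1, h2⟩
    refine ⟨?_, pairValue_inj (step_below hp) hp h2⟩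
    rintro rfl
    exact h1 h0
  · rintro ⟨h1, h2⟩
    refine ⟨fun h => h1 (pairValue_inj hp (below_mk.mpr ⟨hb, hb⟩) (h.trans h0.symm)), by rw [h2]⟩

/-- If `q` is the only nonzero fixed pair, the largest distance of a pair from `q` is one less
than the largest distance of a four-digit number from a nonzero fixed point. -/
theorem isMaxDistance_of_step {b : ℕ} (hb : 0 < b) (q : Sym2 ℕ) (M : ℕ) (hM : 0 < M)
    (hq : ∀ p, Below b p → ((p ≠ s(0, 0) ∧ step b p = p) ↔ p = q))
    (upper : ∀ p, Below b p → ∀ t, (step b)^[t] p = q → (step b)^[M] p = q)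
    (lower : ∃ p, Below b p ∧ (step b)^[M] p = q ∧ (step b)^[M - 1] p ≠ q) :
    IsMaxDistance b (M + 1) := by
  have key : ∀ x t, IsNonzeroFixedPoint b ((kaprekar b)^[t + 1] x) ↔
      (step b)^[t] (digitDiffs b x) = q := by
    intro x t
    have hbel := step_iterate_below (digitDiffs_below b x hb) t
    rw [kaprekar_iterate_succ hb, isNonzeroFixedPoint_pairValue hb hbel, hq _ hbel]
  have mono : ∀ x t, IsNonzeroFixedPoint b ((kaprekar b)^[t] x) →
      IsNonzeroFixedPoint b ((kaprekar b)^[t + 1] x) := by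
    intro x t h
    rw [Function.iterate_succ_apply', h.2]
    exact h
  constructor
  · obtain ⟨p, hp, h1, h2⟩ := lower
    induction p with | _ u v
    rw [below_mk] at hp
    refine ⟨u + b * v, ?_, ?_, ?_⟩
    · have h3 : u + b * v < b ^ 2 := by nlinarith
      exact h3.trans_le (Nat.pow_le_pow_right hb (by omega))
    · rw [Set.mem_ofPred_eq, key, digitDiffs_add_mul hp.1 hp.2]
      exact h1
    · intro t ht
      by_contra! hlt
      have h3 : ∀ j, IsNonzeroFixedPoint b ((kaprekar b)^[t + j] (u + b * v)) := by
        intro j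
        induction j with
        | zero => exact ht
        | succ j ih => exact mono _ _ ih
      have h4 := h3 (M - t)
      rw [show t + (M - t) = (M - 1) + 1 by omega, key, digitDiffs_add_mul hp.1 hp.2] at h4
      exact h2 h4
  · rintro t ⟨x, -, h1, h2⟩
    rcases Nat.eq_zero_or_pos t with rfl | ht
    · omega
    apply h2
    rw [Set.mem_ofPred_eq, key]
    apply upper _ (digitDiffs_below b x hb) (t - 1)
    rw [← key, Nat.sub_add_cancel ht]
    exact h1

/-! ### Arithmetic of the folding map -/

theorem fold_le {b x : ℕ} (hx : x ≤ b) : fold b x ≤ b := by unfold fold; omega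

theorem fold_lt {b x : ℕ} (hx : 0 < x) (hxb : x < b) : fold b x < b := by unfold fold; omega

theorem fold_self (b : ℕ) : fold b b = b := by unfold fold; omega

theorem fold_zero (b : ℕ) : fold b 0 = b := by unfold fold; omega

theorem fold_mul (m b x : ℕ) : fold (m * b) (m * x) = m * fold b x := by
  unfold fold
  rw [mul_left_comm 2 m x, ← Nat.mul_sub, ← Nat.mul_sub, mul_add]

theorem fold_iterate_mul (m b x t : ℕ) :
    (fold (m * b))^[t] (m * x) = m * (fold b)^[t] x := by
  induction t with
  | zero => rfl
  | succ t ih => rw [Function.iterate_succ_apply', Function.iterate_succ_apply', ih, fold_mul]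

theorem fold_iterate_le {b x : ℕ} (hx : x ≤ b) (t : ℕ) : (fold b)^[t] x ≤ b := by
  induction t with
  | zero => exact hx
  | succ t ih => rw [Function.iterate_succ_apply']; exact fold_le ih

theorem fold_iterate_self (b t : ℕ) : (fold b)^[t] b = b := Function.iterate_fixed (fold_self b) t

theorem fold_cast (b x : ℕ) : (fold b x : ℤ) = b - 2 * x ∨ (fold b x : ℤ) = 2 * x - b := by
  unfold fold; omega

/-- Up to sign and modulo `2 * b`, the iterates of `fold b` are given by doubling. -/
theorem fold_iterate_succ_dvd (b x t : ℕ) :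
    (2 * b : ℤ) ∣ 2 ^ (t + 1) * x + b - (fold b)^[t + 1] x ∨
      (2 * b : ℤ) ∣ 2 ^ (t + 1) * x + b + (fold b)^[t + 1] x := by
  induction t with
  | zero =>
    rcases fold_cast b x with h | h
    · right
      exact ⟨1, by simp only [zero_add, pow_one, Function.iterate_one, h]; ring⟩
    · left
      exact ⟨1, by simp only [zero_add, pow_one, Function.iterate_one, h]; ring⟩
  | succ t ih =>
    rw [Function.iterate_succ_apply' _ (t + 1)]
    generalize (fold b)^[t + 1] x = y at *
    rcases fold_cast b y with h | h <;> rw [h] <;> rcases ih with ⟨q, hq⟩ | ⟨q, hq⟩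
    · right
      exact ⟨2 * q, by rw [pow_succ]; linear_combination 2 * hq⟩
    · left
      exact ⟨2 * q - 1, by rw [pow_succ]; linear_combination 2 * hq⟩
    · left
      exact ⟨2 * q, by rw [pow_succ]; linear_combination 2 * hq⟩
    · right
      exact ⟨2 * q - 1, by rw [pow_succ]; linear_combination 2 * hq⟩

/-- The interval `[0, b]` meets each class of integers modulo `2 * b` and sign exactly once. -/
theorem eq_of_dvd_sub_or_add {b v w : ℕ} (hv : v ≤ b) (hw : w ≤ b)
    (h : (2 * b : ℤ) ∣ v - w ∨ (2 * b : ℤ) ∣ v + w) : v = w := by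
  rcases Nat.eq_zero_or_pos b with rfl | hb
  · omega
  rcases h with h | h
  · have := Int.eq_zero_of_abs_lt_dvd h (by rw [abs_lt]; omega)
    omega
  · have h' : 2 * b ∣ v + w := by exact_mod_cast h
    obtain ⟨q, hq⟩ := h'
    have : q < 2 := by
      by_contra! hq2
      nlinarith
    interval_cases q <;> omega

theorem fold_iterate_eq {b x t v : ℕ} (hx : x ≤ b) (ht : 0 < t) (hv : v ≤ b)
    (h : (2 * b : ℤ) ∣ 2 ^ t * x + b - v ∨ (2 * b : ℤ) ∣ 2 ^ t * x + b + v) :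
    (fold b)^[t] x = v := by
  obtain ⟨t, rfl⟩ := Nat.exists_eq_add_of_le' ht
  apply eq_of_dvd_sub_or_add (fold_iterate_le hx _) hv
  rcases fold_iterate_succ_dvd b x t with ⟨q, hq⟩ | ⟨q, hq⟩ <;> rcases h with ⟨r, hr⟩ | ⟨r, hr⟩
  · left; exact ⟨r - q, by linear_combination hr - hq⟩
  · right; exact ⟨r - q, by linear_combination hr - hq⟩
  · right; exact ⟨q - r, by linear_combination hq - hr⟩
  · left; exact ⟨q - r, by linear_combination hq - hr⟩

/-! ### Rules of the pair dynamics and the fixed pair -/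

theorem step_zero_zero (b : ℕ) : step b s(0, 0) = s(0, 0) := by simp [step_mk, stepPair]

theorem step_iterate_zero_zero (b t : ℕ) : (step b)^[t] s(0, 0) = s(0, 0) :=
  Function.iterate_fixed (step_zero_zero b) t

theorem step_zero_right {b w : ℕ} (hw : 0 < w) : step b s(w, 0) = s(b - w, w - 1) := by
  simp [step_mk, stepPair, hw.ne']

theorem step_collision {b x y : ℕ} (hx : 0 < x) (hy : 0 < y) (h : fold b x = fold b y) :
    step b s(x, y) = s(fold b x + 1, (fold b x - 1) + (1 - fold b x)) := by
  simp [step_mk, stepPair, hx.ne', hy.ne', h]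

theorem step_regular {b x y : ℕ} (hx : 0 < x) (hy : 0 < y) (h : fold b x ≠ fold b y) :
    step b s(x, y) = s(fold b x, fold b y) := by
  simp [step_mk, stepPair, hx.ne', hy.ne', h]

theorem step_cases (b x y : ℕ) :
    (x = 0 ∧ y = 0) ∨ (∃ w, 0 < w ∧ s(x, y) = s(w, 0) ∧ step b s(x, y) = s(b - w, w - 1)) ∨
    (0 < x ∧ 0 < y ∧ fold b x = fold b y ∧
      step b s(x, y) = s(fold b x + 1, (fold b x - 1) + (1 - fold b x))) ∨
    (0 < x ∧ 0 < y ∧ fold b x ≠ fold b y ∧ step b s(x, y) = s(fold b x, fold b y)) := by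
  rcases Nat.eq_zero_or_pos x with rfl | hx <;> rcases Nat.eq_zero_or_pos y with rfl | hy
  · simp
  · exact Or.inr (Or.inl ⟨y, hy, Sym2.eq_swap, by rw [Sym2.eq_swap, step_zero_right hy]⟩)
  · exact Or.inr (Or.inl ⟨x, hx, rfl, step_zero_right hx⟩)
  · by_cases h : fold b x = fold b y
    · exact Or.inr (Or.inr (Or.inl ⟨hx, hy, h, step_collision hx hy h⟩))
    · exact Or.inr (Or.inr (Or.inr ⟨hx, hy, h, step_regular hx hy h⟩))

/-- As long as the entries stay distinct and do not run into `0`, they evolve independently. -/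
theorem step_iterate_regular {b x y t : ℕ} (hx : (fold b)^[t] x ≠ b) (hy : (fold b)^[t] y ≠ b)
    (hxy : (fold b)^[t] x ≠ (fold b)^[t] y) :
    (step b)^[t] s(x, y) = s((fold b)^[t] x, (fold b)^[t] y) := by
  induction t with
  | zero => rfl
  | succ t ih =>
    simp only [Function.iterate_succ_apply'] at hx hy hxy
    have hx' : (fold b)^[t] x ≠ b := fun h => hx (by rw [h, fold_self])
    have hy' : (fold b)^[t] y ≠ b := fun h => hy (by rw [h, fold_self])
    have hx0 : (fold b)^[t] x ≠ 0 := fun h => hx (by rw [h, fold_zero])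
    have hy0 : (fold b)^[t] y ≠ 0 := fun h => hy (by rw [h, fold_zero])
    rw [Function.iterate_succ_apply', ih hx' hy' (fun h => hxy (by rw [h])),
      step_regular (Nat.pos_of_ne_zero hx0) (Nat.pos_of_ne_zero hy0) hxy,
      Function.iterate_succ_apply', Function.iterate_succ_apply']

/-- The zero and collision rules have nonzero fixed pairs only in bases `2` and `4`. Under the
regular rule distinct entries must be exchanged by `fold`, which forces `3 * k` and `k`. -/
theorem fixed_pair_iff {k : ℕ} (hk : 0 < k) (p : Sym2 ℕ) (hp : Below (5 * k) p) :
    (p ≠ s(0, 0) ∧ step (5 * k) p = p) ↔ p = s(3 * k, k) := by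
  constructor
  · induction p with | _ x y
    rw [below_mk] at hp
    rintro ⟨h0, h⟩
    rcases step_cases (5 * k) x y with ⟨rfl, rfl⟩ | ⟨w, hw, e, h'⟩ | ⟨hx, hy, e, h'⟩ |
      ⟨hx, hy, e, h'⟩
    · exact absurd rfl h0
    · rw [h, e, Sym2.eq_iff] at h'
      rw [Sym2.eq_iff] at e
      omega
    · rw [h, Sym2.eq_iff] at h'
      unfold fold at e h'
      omega
    · rw [h, Sym2.eq_iff] at h'
      rw [Sym2.eq_iff]
      unfold fold at e h'
      omega
  · rintro rfl
    refine ⟨by rw [Ne, Sym2.eq_iff]; omega, ?_⟩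
    have e1 : fold (5 * k) (3 * k) = k := by unfold fold; omega
    have e2 : fold (5 * k) k = 3 * k := by unfold fold; omega
    rw [step_regular (by omega) hk (by omega), e1, e2, Sym2.eq_swap]

theorem step_fixed {k : ℕ} (hk : 0 < k) : step (5 * k) s(3 * k, k) = s(3 * k, k) :=
  (((fixed_pair_iff hk _ (below_mk.mpr (by omega))).mpr rfl)).2

/-! ### Finite distances and small bases -/

/-- If the pair `p` ever reaches `q`, it is at `q` after `t` steps. -/
def ReachesWithin (b : ℕ) (q p : Sym2 ℕ) (t : ℕ) : Prop :=
  ∀ j, (step b)^[j] p = q → (step b)^[t] p = q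

/-- The largest distance in base `5 * k`, in terms of the dynamics on pairs. -/
theorem isMaxDistance_five_mul {k : ℕ} (hk : 0 < k) (M : ℕ) (hM : 0 < M)
    (upper : ∀ p, Below (5 * k) p → ReachesWithin (5 * k) s(3 * k, k) p M)
    (lower : ∃ p, Below (5 * k) p ∧ (step (5 * k))^[M] p = s(3 * k, k) ∧
      (step (5 * k))^[M - 1] p ≠ s(3 * k, k)) :
    IsMaxDistance (5 * k) (M + 1) :=
  isMaxDistance_of_step (by omega) _ M hM (fixed_pair_iff hk) upper lower

theorem reachesWithin_of_eq {b t : ℕ} {p q : Sym2 ℕ} (h : (step b)^[t] p = q) :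
    ReachesWithin b q p t := fun _ _ => h

theorem ReachesWithin.mono {b t t' : ℕ} {p q : Sym2 ℕ} (hq : step b q = q)
    (h : ReachesWithin b q p t) (ht : t ≤ t') : ReachesWithin b q p t' := by
  intro j hj
  obtain ⟨d, rfl⟩ := Nat.exists_eq_add_of_le' ht
  rw [Function.iterate_add_apply, h j hj, Function.iterate_fixed hq]

theorem ReachesWithin.of_iterate {b t d : ℕ} {p p' q : Sym2 ℕ} (hq : step b q = q)
    (h : ReachesWithin b q p' t) (hp : (step b)^[d] p = p') : ReachesWithin b q p (t + d) := by
  intro j hj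
  subst hp
  rw [Function.iterate_add_apply]
  apply h j
  rw [← Function.iterate_add_apply, add_comm, Function.iterate_add_apply, hj,
    Function.iterate_fixed hq]

theorem reachesWithin_of_cycle {b d t : ℕ} {p q : Sym2 ℕ} (hd : 0 < d)
    (hcyc : (step b)^[d] p = p) (hq : step b q = q) : ReachesWithin b q p t := by
  intro j hj
  have h1 : (step b)^[d * j] p = p := by
    rw [Function.iterate_mul]
    exact Function.iterate_fixed hcyc j
  obtain ⟨e, he⟩ := Nat.exists_eq_add_of_le' (Nat.le_mul_of_pos_left j hd)
  rw [he, Function.iterate_add_apply, hj, Function.iterate_fixed hq] at h1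
  rw [← h1, Function.iterate_fixed hq]

/-- Makes a fixed base decidable: after `M` steps each pair is at the target or on a cycle of period
dividing `d`, and a cycle off the target never arrives. -/
theorem isMaxDistance_of_forall_lt {b M : ℕ} (u v d : ℕ) (hM : 0 < M) (hd : 0 < d)
    (huv : u < b ∧ v < b)
    (hq : ∀ x < b, ∀ y < b, (s(x, y) ≠ s(0, 0) ∧ step b s(x, y) = s(x, y)) ↔ s(x, y) = s(u, v))
    (upper : ∀ x < b, ∀ y < b, (step b)^[M] s(x, y) = s(u, v) ∨
      (step b)^[d] ((step b)^[M] s(x, y)) = (step b)^[M] s(x, y))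
    (lower : ∃ x < b, ∃ y < b, (step b)^[M] s(x, y) = s(u, v) ∧
      (step b)^[M - 1] s(x, y) ≠ s(u, v)) : IsMaxDistance b (M + 1) := by
  have hfix : step b s(u, v) = s(u, v) := ((hq u huv.1 v huv.2).mpr rfl).2
  refine isMaxDistance_of_step (by omega) s(u, v) M hM (fun p hp => ?_) (fun p hp => ?_) ?_
  · induction p with | _ x y
    rw [below_mk] at hp
    exact hq x hp.1 y hp.2
  · induction p with | _ x y
    rw [below_mk] at hp
    rcases upper x hp.1 y hp.2 with h | h
    · exact reachesWithin_of_eq h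
    · have h' : ReachesWithin b s(u, v) ((step b)^[M] s(x, y)) 0 :=
        reachesWithin_of_cycle hd h hfix
      have h'' := h'.of_iterate hfix rfl
      rwa [zero_add] at h''
  · obtain ⟨x, hx, y, hy, h⟩ := lower
    exact ⟨s(x, y), below_mk.mpr ⟨hx, hy⟩, h⟩

theorem isMaxDistance_four : IsMaxDistance 4 3 :=
  isMaxDistance_of_forall_lt (M := 2) 3 1 6 (by omega) (by omega) (by omega)
    (by decide +kernel) (by decide +kernel) (by decide +kernel)

theorem isMaxDistance_five : IsMaxDistance 5 4 :=
  isMaxDistance_of_forall_lt (M := 3) 3 1 1 (by omega) (by omega) (by omega)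
    (by decide +kernel) (by decide +kernel) (by decide +kernel)

theorem isMaxDistance_ten : IsMaxDistance 10 7 :=
  isMaxDistance_of_forall_lt (M := 6) 6 2 1 (by omega) (by omega) (by omega)
    (by decide +kernel) (by decide +kernel) (by decide +kernel)

theorem isMaxDistance_twenty : IsMaxDistance 20 10 :=
  isMaxDistance_of_forall_lt (M := 9) 12 4 6 (by omega) (by omega) (by omega)
    (by decide +kernel) (by decide +kernel) (by decide +kernel)

/-- Here pairs would need `M = 0`, which `isMaxDistance_of_step` excludes. Instead, every image
under the map is already fixed. -/
theorem isMaxDistance_two : IsMaxDistance 2 1 := by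
  have h7 : kaprekar 2 7 = 7 := by decide +kernel
  have h1 : kaprekar 2 1 = 7 := by decide +kernel
  constructor
  · refine ⟨1, by norm_num, ?_, ?_⟩
    · show IsNonzeroFixedPoint 2 ((kaprekar 2)^[1] 1)
      rw [Function.iterate_one, h1]
      exact ⟨by norm_num, h7⟩
    · intro t ht
      by_contra! h
      obtain rfl : t = 0 := by omega
      have h' : kaprekar 2 1 = 1 := ht.2
      omega
  · rintro t ⟨x, hx, ht, hmin⟩
    have hfix : ∀ x < 2 ^ 4, kaprekar 2 (kaprekar 2 x) = kaprekar 2 x := by decide +kernel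
    rcases Nat.eq_zero_or_pos t with rfl | ht0
    · omega
    · apply hmin
      obtain ⟨t, rfl⟩ := Nat.exists_eq_add_of_le' ht0
      rw [Set.mem_ofPred_eq, Function.iterate_succ_apply,
        Function.iterate_fixed (hfix x hx)] at ht
      exact ht

/-! ### Bases with an odd factor beyond 5 -/

/-- Divisibility by `m` is pulled back from the target. A zero would make `m` divide `b - w` and `w
- 1`, hence `1`; a collision would make it divide `2`. A regular step gives `m ∣ 2 * z`, hence `m ∣
z`. -/
theorem dvd_of_reaches {m k : ℕ} (hm : Odd m) (hm1 : 1 < m) (hk : 0 < k) (hmk : m ∣ k) :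
    ∀ t x y, x < 5 * k → y < 5 * k → (step (5 * k))^[t] s(x, y) = s(3 * k, k) →
      m ∣ x ∧ m ∣ y ∧ ∀ j ≤ t, (step (5 * k))^[j] s(x, y) =
        s((fold (5 * k))^[j] x, (fold (5 * k))^[j] y) := by
  have hmb : m ∣ 5 * k := hmk.mul_left 5
  have hcop : Nat.Coprime m 2 := hm.coprime_two_right
  intro t
  induction t with
  | zero =>
    intro x y _ _ h
    refine ⟨?_, ?_, fun j hj => by rw [Nat.le_zero.mp hj]; rfl⟩
    all_goals
      rw [Function.iterate_zero, id, Sym2.eq_iff] at h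
      rcases h with ⟨rfl, rfl⟩ | ⟨rfl, rfl⟩ <;> first | exact hmk | exact hmk.mul_left 3
  | succ t ih =>
    intro x y hx hy h
    rw [Function.iterate_succ_apply] at h
    rcases step_cases (5 * k) x y with ⟨rfl, rfl⟩ | ⟨w, hw, e, h'⟩ | ⟨hx0, hy0, e, h'⟩ |
      ⟨hx0, hy0, e, h'⟩
    · rw [step_zero_zero, step_iterate_zero_zero, Sym2.eq_iff] at h
      omega
    · have hwb : w < 5 * k := by rw [Sym2.eq_iff] at e; omega
      rw [h'] at h
      obtain ⟨h1, h2, -⟩ := ih _ _ (by omega) (by omega) h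
      have h3 := (Nat.dvd_sub hmb h1)
      rw [Nat.sub_sub_self hwb.le] at h3
      have h4 := Nat.dvd_sub h3 h2
      rw [Nat.sub_sub_self hw, Nat.dvd_one] at h4
      omega
    · rw [h'] at h
      have hu := fold_lt hx0 hx
      have hpar : fold (5 * k) x + 1 < 5 * k := by
        unfold fold at hu ⊢
        omega
      obtain ⟨h1, h2, -⟩ := ih _ _ hpar (by omega) h
      have h3 : m ∣ 2 := by
        rcases Nat.eq_zero_or_pos (fold (5 * k) x) with h0 | h0
        · rw [h0] at h1
          exact h1.trans (by norm_num)
        · have := Nat.dvd_sub h1 h2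
          rwa [show fold (5 * k) x + 1 - (fold (5 * k) x - 1 + (1 - fold (5 * k) x)) = 2
            by omega] at this
      have := Nat.Coprime.eq_one_of_dvd hcop h3
      omega
    · rw [h'] at h
      obtain ⟨h1, h2, h3⟩ := ih _ _ (fold_lt hx0 hx) (fold_lt hy0 hy) h
      have hd : ∀ z, m ∣ fold (5 * k) z → m ∣ z := by
        intro z hz
        have : (m : ℤ) ∣ 2 * z := by
          have h5 : (m : ℤ) ∣ (5 * k : ℕ) := Int.natCast_dvd_natCast.mpr hmb
          have h6 : (m : ℤ) ∣ (fold (5 * k) z : ℕ) := Int.natCast_dvd_natCast.mpr hz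
          rcases fold_cast (5 * k) z with h7 | h7
          · have := dvd_sub h5 h6
            rw [h7] at this
            simpa using this
          · have := dvd_add h5 h6
            rw [h7] at this
            simpa using this
        have h8 : m ∣ 2 * z := by exact_mod_cast this
        exact hcop.dvd_of_dvd_mul_left h8
      refine ⟨hd _ h1, hd _ h2, fun j hj => ?_⟩
      cases j with
      | zero => rfl
      | succ j =>
        rw [Function.iterate_succ_apply, h', h3 j (by omega), Function.iterate_succ_apply,
          Function.iterate_succ_apply]

/-- After `n + 1` doublings the congruence modulo `10 * 2 ^ n` cancels to one for `2 * x + 5` modulo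
`10`, which sees only `x` modulo `5`. -/
theorem fold_iterate_terminal {n x : ℕ} (hx : x ≤ 5 * 2 ^ n) :
    (x % 5 = 0 → (fold (5 * 2 ^ n))^[n + 1] x = 5 * 2 ^ n) ∧
    (x % 5 = 1 ∨ x % 5 = 4 → (fold (5 * 2 ^ n))^[n + 1] x = 3 * 2 ^ n) ∧
    (x % 5 = 2 ∨ x % 5 = 3 → (fold (5 * 2 ^ n))^[n + 1] x = 2 ^ n) := by
  have hd : ∀ c : ℤ, (10 : ℤ) ∣ c → (2 * (5 * 2 ^ n : ℕ) : ℤ) ∣ 2 ^ n * c := by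
    rintro c ⟨q, rfl⟩
    exact ⟨q, by push_cast; ring⟩
  have key : ∀ r : ℕ, r ≤ 5 → ((10 : ℤ) ∣ 2 * x + 5 - r ∨ (10 : ℤ) ∣ 2 * x + 5 + r) →
      (fold (5 * 2 ^ n))^[n + 1] x = r * 2 ^ n := by
    intro r hr h
    refine fold_iterate_eq hx n.succ_pos (Nat.mul_le_mul_right _ hr) ?_
    rcases h with h | h
    · left
      convert hd _ h using 1
      push_cast
      ring
    · right
      convert hd _ h using 1
      push_cast
      ring
  refine ⟨fun h => key 5 (by omega) ?_, fun h => key 3 (by omega) ?_, fun h => ?_⟩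
  · omega
  · omega
  · rw [key 1 (by omega) (by omega), one_mul]

theorem isMaxDistance_of_odd_factor {m n : ℕ} (hm : Odd m) (hm1 : 1 < m) :
    IsMaxDistance (5 * m * 2 ^ n) (n + 2) := by
  have hk : 0 < m * 2 ^ n := by positivity
  have hb : 5 * (m * 2 ^ n) = m * (5 * 2 ^ n) := by ring
  have h2n : 0 < 2 ^ n := by positivity
  rw [mul_assoc]
  refine isMaxDistance_five_mul hk (n + 1) (by omega) (fun p hp t ht => ?_) ?_
  · induction p with | _ x y
    rw [below_mk] at hp
    obtain ⟨⟨x, rfl⟩, ⟨y, rfl⟩, h⟩ :=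
      dvd_of_reaches hm hm1 hk (dvd_mul_right m _) t _ _ hp.1 hp.2 ht
    rcases le_or_gt t (n + 1) with htn | htn
    · obtain ⟨d, hd⟩ := Nat.exists_eq_add_of_le' htn
      rw [hd, Function.iterate_add_apply, ht, Function.iterate_fixed (step_fixed hk)]
    rw [h t le_rfl] at ht
    -- Arrival after `n + 1` steps is still possible only if neither entry is the absorbing `b` and
    -- the entries differ, so they are already the target.
    rw [h (n + 1) htn.le]
    rw [hb] at hp ht ⊢
    simp only [fold_iterate_mul] at ht ⊢
    have hx : x ≤ 5 * 2 ^ n := le_of_lt (Nat.lt_of_mul_lt_mul_left hp.1)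
    have hy : y ≤ 5 * 2 ^ n := le_of_lt (Nat.lt_of_mul_lt_mul_left hp.2)
    obtain ⟨x0, x1, x2⟩ := fold_iterate_terminal hx
    obtain ⟨y0, y1, y2⟩ := fold_iterate_terminal hy
    obtain ⟨d, rfl⟩ := Nat.exists_eq_add_of_le' htn.le
    simp only [Function.iterate_add_apply _ d, Sym2.eq_iff] at ht
    have hx' : (fold (5 * 2 ^ n))^[n + 1] x = 5 * 2 ^ n ∨
        (fold (5 * 2 ^ n))^[n + 1] x = 3 * 2 ^ n ∨ (fold (5 * 2 ^ n))^[n + 1] x = 2 ^ n := by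
      omega
    have hy' : (fold (5 * 2 ^ n))^[n + 1] y = 5 * 2 ^ n ∨
        (fold (5 * 2 ^ n))^[n + 1] y = 3 * 2 ^ n ∨ (fold (5 * 2 ^ n))^[n + 1] y = 2 ^ n := by
      omega
    have e5 : m * (5 * 2 ^ n) = 5 * (m * 2 ^ n) := by ring
    have e3 : m * (3 * 2 ^ n) = 3 * (m * 2 ^ n) := by ring
    rw [Sym2.eq_iff]
    rcases hx' with hx' | hx' | hx' <;> rcases hy' with hy' | hy' | hy' <;>
      rw [hx', hy'] at ht ⊢ <;>
      simp only [fold_iterate_self, e5, e3, and_self, true_or, or_true] at ht ⊢ <;> omega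
  · have hfold : ∀ t z, (fold (5 * (m * 2 ^ n)))^[t] (m * z) = m * (fold (5 * 2 ^ n))^[t] z := by
      intro t z
      rw [hb, fold_iterate_mul]
    have h1 := (fold_iterate_terminal (n := n) (x := 1) (by omega)).2.1 (by omega)
    have h2 := (fold_iterate_terminal (n := n) (x := 2) (by omega)).2.2 (by omega)
    have e3 : m * (3 * 2 ^ n) = 3 * (m * 2 ^ n) := by ring
    have hreg : (step (5 * (m * 2 ^ n)))^[n + 1] s(m * 1, m * 2) =
        s(3 * (m * 2 ^ n), m * 2 ^ n) := by
      rw [step_iterate_regular] <;> simp only [hfold, h1, h2, e3] <;> omega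
    have hlt : m * 2 < 5 * (m * 2 ^ n) := by nlinarith
    -- Residues `1` and `2` lie in different classes; for `n > 0`, after `n` folds the entries are
    -- `4 * k` and `3 * k`, one step short.
    refine ⟨s(m * 1, m * 2), below_mk.mpr (by omega), hreg, ?_⟩
    rw [Nat.add_sub_cancel]
    rcases Nat.eq_zero_or_pos n with rfl | hn
    · rw [Function.iterate_zero, id, Ne, Sym2.eq_iff]
      omega
    have h3 : (fold (5 * 2 ^ n))^[n] 1 = 4 * 2 ^ n :=
      fold_iterate_eq (by omega) hn (by omega) (Or.inr ⟨1, by push_cast; ring⟩)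
    have h4 : (fold (5 * 2 ^ n))^[n] 2 = 3 * 2 ^ n :=
      fold_iterate_eq (by omega) hn (by omega) (Or.inr ⟨1, by push_cast; ring⟩)
    have e4 : m * (4 * 2 ^ n) = 4 * (m * 2 ^ n) := by ring
    rw [step_iterate_regular] <;> simp only [hfold, h3, h4, e3, e4, Ne, Sym2.eq_iff] <;> omega

/-! ### Bases 5·2ⁿ: vanishing entries and collisions -/

theorem two_mul_five_mul_two_pow_cast (t a : ℕ) :
    (2 * (5 * 2 ^ (t + a) : ℕ) : ℤ) = 2 ^ t * (10 * 2 ^ a) := by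
  push_cast
  ring

/-- Cancelling `2 ^ t` from the doubling congruence leaves `r ≡ ±(x + 5 * 2 ^ a)` modulo `10 * 2 ^
a`. -/
theorem fold_iterate_scaled {t a x : ℕ} (ht : 0 < t) (hx : x ≤ 5 * 2 ^ (t + a)) :
    ∃ r : ℕ, r ≤ 5 * 2 ^ a ∧ (fold (5 * 2 ^ (t + a)))^[t] x = 2 ^ t * r ∧
      ((10 * 2 ^ a : ℤ) ∣ x + 5 * 2 ^ a - r ∨ (10 * 2 ^ a : ℤ) ∣ x + 5 * 2 ^ a + r) := by
  obtain ⟨t, rfl⟩ := Nat.exists_eq_add_of_le' ht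
  have h2 : (2 : ℤ) ^ (t + 1) ≠ 0 := by positivity
  have hle := fold_iterate_le hx (t + 1)
  have hd := fold_iterate_succ_dvd (5 * 2 ^ (t + 1 + a)) x t
  generalize (fold (5 * 2 ^ (t + 1 + a)))^[t + 1] x = v at *
  have e : ((5 * 2 ^ (t + 1 + a) : ℕ) : ℤ) = 2 ^ (t + 1) * (5 * 2 ^ a) := by push_cast; ring
  rw [two_mul_five_mul_two_pow_cast, e, ← mul_add] at hd
  have hv : 2 ^ (t + 1) ∣ v := by
    have h' : (2 : ℤ) ^ (t + 1) ∣ v := by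
      rcases hd with hd | hd
      · exact (dvd_sub_right (dvd_mul_right _ _)).mp ((dvd_mul_right _ _).trans hd)
      · exact (dvd_add_right (dvd_mul_right _ _)).mp ((dvd_mul_right _ _).trans hd)
    exact_mod_cast h'
  obtain ⟨r, rfl⟩ := hv
  refine ⟨r, ?_, rfl, ?_⟩
  · have : 2 ^ (t + 1) * r ≤ 2 ^ (t + 1) * (5 * 2 ^ a) := by
      refine hle.trans (le_of_eq ?_)
      ring
    exact Nat.le_of_mul_le_mul_left this (by positivity)
  · push_cast at hd
    rw [← mul_sub, ← mul_add] at hd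
    exact hd.imp (fun h => (mul_dvd_mul_iff_left h2).mp h) (fun h => (mul_dvd_mul_iff_left h2).mp h)

theorem fold_iterate_scaled_eq {t a x r : ℕ} (ht : 0 < t) (hx : x ≤ 5 * 2 ^ (t + a))
    (hr : r ≤ 5 * 2 ^ a)
    (h : (10 * 2 ^ a : ℤ) ∣ x + 5 * 2 ^ a - r ∨ (10 * 2 ^ a : ℤ) ∣ x + 5 * 2 ^ a + r) :
    (fold (5 * 2 ^ (t + a)))^[t] x = 2 ^ t * r := by
  have e : ((5 * 2 ^ (t + a) : ℕ) : ℤ) = 2 ^ t * (5 * 2 ^ a) := by push_cast; ring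
  refine fold_iterate_eq hx ht ?_ ?_
  · calc 2 ^ t * r ≤ 2 ^ t * (5 * 2 ^ a) := Nat.mul_le_mul_left _ hr
      _ = 5 * 2 ^ (t + a) := by ring
  · rw [two_mul_five_mul_two_pow_cast, e]
    push_cast
    rw [← mul_add, ← mul_sub, ← mul_add]
    exact h.imp (mul_dvd_mul_left _) (mul_dvd_mul_left _)

/-- A multiple of `5` whose partner survives is driven to `0`, after which the partner `w`
gives the pair `s(b - w, w - 1)`. -/
theorem step_iterate_zero {t a c y : ℕ} (ht : 0 < t) (hc : Odd c)
    (hx : 5 * 2 ^ a * c < 5 * 2 ^ (t + a)) (hy : y < 5 * 2 ^ (t + a)) (hay : ¬ 5 * 2 ^ a ∣ y) :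
    ∃ r : ℕ, 0 < r ∧ r < 5 * 2 ^ a ∧
      ((10 * 2 ^ a : ℤ) ∣ y + 5 * 2 ^ a - r ∨ (10 * 2 ^ a : ℤ) ∣ y + 5 * 2 ^ a + r) ∧
      (step (5 * 2 ^ (t + a)))^[t + 1] s(5 * 2 ^ a * c, y) =
        s(5 * 2 ^ (t + a) - 2 ^ t * r, 2 ^ t * r - 1) := by
  have h0 : (fold (5 * 2 ^ (t + a)))^[t] (5 * 2 ^ a * c) = 0 := by
    rw [fold_iterate_scaled_eq (r := 0) ht hx.le (Nat.zero_le _), mul_zero]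
    obtain ⟨d, rfl⟩ := hc
    left
    exact ⟨d + 1, by push_cast; ring⟩
  obtain ⟨r, hr, hfold, hd⟩ := fold_iterate_scaled ht hy.le
  have hay' : ¬ (5 * 2 ^ a : ℤ) ∣ y := fun h => hay (by exact_mod_cast h)
  have hr0 : r ≠ 0 := by
    rintro rfl
    apply hay'
    have h1 : (10 * 2 ^ a : ℤ) ∣ y + 5 * 2 ^ a := by simpa using hd
    exact (dvd_add_left (dvd_refl _)).mp ((Dvd.intro 2 (by ring)).trans h1)
  have hr5 : r ≠ 5 * 2 ^ a := by
    rintro rfl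
    apply hay'
    push_cast at hd
    rcases hd with ⟨q, hq⟩ | ⟨q, hq⟩
    · exact ⟨2 * q, by linear_combination hq⟩
    · exact ⟨2 * q - 2, by linear_combination hq⟩
  have hlt : r < 5 * 2 ^ a := lt_of_le_of_ne hr hr5
  have hpos : 0 < 2 ^ t * r := by positivity
  have hlt' : 2 ^ t * r < 5 * 2 ^ (t + a) := by
    calc 2 ^ t * r < 2 ^ t * (5 * 2 ^ a) := Nat.mul_lt_mul_of_pos_left hlt (by positivity)
      _ = 5 * 2 ^ (t + a) := by ring
  refine ⟨r, Nat.pos_of_ne_zero hr0, hlt, hd, ?_⟩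
  rw [Function.iterate_succ_apply', step_iterate_regular, h0, hfold, Sym2.eq_swap,
    step_zero_right hpos]
  · rw [h0]; omega
  · rw [hfold]; omega
  · rw [h0, hfold]; omega

theorem step_iterate_terminal {n x y : ℕ} (hx : x ≤ 5 * 2 ^ n) (hy : y ≤ 5 * 2 ^ n)
    (h : ((x % 5 = 1 ∨ x % 5 = 4) ∧ (y % 5 = 2 ∨ y % 5 = 3)) ∨
      ((x % 5 = 2 ∨ x % 5 = 3) ∧ (y % 5 = 1 ∨ y % 5 = 4))) :
    (step (5 * 2 ^ n))^[n + 1] s(x, y) = s(3 * 2 ^ n, 2 ^ n) := by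
  have h2 : 0 < 2 ^ n := by positivity
  obtain ⟨-, x1, x2⟩ := fold_iterate_terminal hx
  obtain ⟨-, y1, y2⟩ := fold_iterate_terminal hy
  rcases h with ⟨h3, h4⟩ | ⟨h3, h4⟩
  · rw [step_iterate_regular, x1 h3, y2 h4] <;> omega
  · rw [step_iterate_regular, x2 h3, y1 h4, Sym2.eq_swap] <;> omega

/-- An odd `x` becomes an even multiple of `2 ^ n` after `n` folds, whereas the target has odd
multiples. This gives sharpness. -/
theorem step_iterate_ne_terminal {n x y : ℕ} (hn : 0 < n) (hx : x ≤ 5 * 2 ^ n)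
    (hy : y ≤ 5 * 2 ^ n) (hodd : x % 2 = 1)
    (h : ((x % 5 = 1 ∨ x % 5 = 4) ∧ (y % 5 = 2 ∨ y % 5 = 3)) ∨
      ((x % 5 = 2 ∨ x % 5 = 3) ∧ (y % 5 = 1 ∨ y % 5 = 4))) :
    (step (5 * 2 ^ n))^[n] s(x, y) ≠ s(3 * 2 ^ n, 2 ^ n) := by
  have h2 : 0 < 2 ^ n := by positivity
  obtain ⟨-, x1, x2⟩ := fold_iterate_terminal hx
  obtain ⟨-, y1, y2⟩ := fold_iterate_terminal hy
  obtain ⟨r, hr, hfold, hd⟩ := fold_iterate_scaled (a := 0) hn hx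
  simp only [Function.iterate_succ_apply'] at x1 x2 y1 y2
  rw [add_zero] at hfold
  have hxb : (fold (5 * 2 ^ n))^[n] x ≠ 5 * 2 ^ n := by
    intro e
    rw [e, fold_self] at x1 x2
    omega
  have hyb : (fold (5 * 2 ^ n))^[n] y ≠ 5 * 2 ^ n := by
    intro e
    rw [e, fold_self] at y1 y2
    omega
  have hxy : (fold (5 * 2 ^ n))^[n] x ≠ (fold (5 * 2 ^ n))^[n] y := by
    intro e
    rw [e] at x1 x2
    omega
  have hr2 : r % 2 = 0 := by
    simp only [pow_zero, mul_one] at hd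
    omega
  rw [step_iterate_regular hxb hyb hxy, hfold, Ne, Sym2.eq_iff]
  intro e
  have h3 : 2 ^ n * r = 2 ^ n * 3 ∨ 2 ^ n * r = 2 ^ n * 1 := by omega
  rcases h3 with h3 | h3 <;> have := Nat.eq_of_mul_eq_mul_left h2 h3 <;> omega

/-- Two entries of opposite parity in the same class modulo `5` up to sign collide at the last
possible moment. -/
theorem step_iterate_collision {n x y u : ℕ} (hn : 0 < n) (hx : x ≤ 5 * 2 ^ n)
    (hy : y ≤ 5 * 2 ^ n) (hodd : (x + y) % 2 = 1)
    (h : ((x % 5 = 1 ∨ x % 5 = 4) ∧ (y % 5 = 1 ∨ y % 5 = 4) ∧ u = 3 * 2 ^ n) ∨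
      ((x % 5 = 2 ∨ x % 5 = 3) ∧ (y % 5 = 2 ∨ y % 5 = 3) ∧ u = 2 ^ n)) :
    (step (5 * 2 ^ n))^[n + 1] s(x, y) = s(u + 1, u - 1) := by
  have h2 : 0 < 2 ^ n := by positivity
  obtain ⟨-, x1, x2⟩ := fold_iterate_terminal hx
  obtain ⟨-, y1, y2⟩ := fold_iterate_terminal hy
  obtain ⟨r, hr, hfold, hd⟩ := fold_iterate_scaled (a := 0) hn hx
  obtain ⟨r', hr', hfold', hd'⟩ := fold_iterate_scaled (a := 0) hn hy
  simp only [Function.iterate_succ_apply'] at x1 x2 y1 y2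
  rw [add_zero] at hfold hfold'
  simp only [pow_zero, mul_one] at hd hd'
  have hxu : fold (5 * 2 ^ n) ((fold (5 * 2 ^ n))^[n] x) = u := by
    rcases h with ⟨h3, -, rfl⟩ | ⟨h3, -, rfl⟩
    · exact x1 h3
    · exact x2 h3
  have hyu : fold (5 * 2 ^ n) ((fold (5 * 2 ^ n))^[n] y) = u := by
    rcases h with ⟨-, h3, rfl⟩ | ⟨-, h3, rfl⟩
    · exact y1 h3
    · exact y2 h3
  have hub : u < 5 * 2 ^ n ∧ 0 < u := by
    rcases h with ⟨-, -, rfl⟩ | ⟨-, -, rfl⟩ <;> omega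
  clear h x1 x2 y1 y2
  have aux : ∀ z, fold (5 * 2 ^ n) z = u → z ≠ 5 * 2 ^ n ∧ 0 < z := by
    intro z hz
    unfold fold at hz
    omega
  have hxy : (fold (5 * 2 ^ n))^[n] x ≠ (fold (5 * 2 ^ n))^[n] y := by
    rw [hfold, hfold']
    intro e
    have := Nat.eq_of_mul_eq_mul_left h2 e
    omega
  rw [Function.iterate_succ_apply', step_iterate_regular (aux _ hxu).1 (aux _ hyu).1 hxy,
    step_collision (aux _ hxu).2 (aux _ hyu).2 (hxu.trans hyu.symm), hxu, Sym2.eq_iff]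
  omega

/-- Take the first coincidence. Hitting `0` or `b` earlier would have absorbed the entry at `b`, so
the motion is regular until then. -/
theorem exists_step_iterate_collision {b x y t : ℕ} (ht : 0 < t) (hb : (fold b)^[t] x ≠ b)
    (hxy : (fold b)^[t] x = (fold b)^[t] y) :
    ∃ j, 0 < j ∧ j ≤ t ∧ (step b)^[j] s(x, y) =
      s((fold b)^[j] x + 1, ((fold b)^[j] x - 1) + (1 - (fold b)^[j] x)) := by
  classical
  have hex : ∃ j, (fold b)^[j + 1] x = (fold b)^[j + 1] y := ⟨t - 1, by rwa [Nat.sub_add_cancel ht]⟩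
  have hj := Nat.find_spec hex
  have hmin : ∀ i < Nat.find hex, (fold b)^[i + 1] x ≠ (fold b)^[i + 1] y :=
    fun i hi => Nat.find_min hex hi
  have hjt : Nat.find hex ≤ t - 1 := Nat.find_min' hex (by rwa [Nat.sub_add_cancel ht])
  generalize Nat.find hex = j at *
  have hend : ∀ z, (fold b)^[t] z ≠ b → (fold b)^[j] z ≠ b ∧ 0 < (fold b)^[j] z := by
    intro z hz
    obtain ⟨d, hd⟩ := Nat.exists_eq_add_of_le' (show j + 1 ≤ t by omega)
    rw [hd, Function.iterate_add_apply, Function.iterate_succ_apply'] at hz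
    constructor
    · intro e
      rw [e, fold_self, fold_iterate_self] at hz
      exact hz rfl
    · refine Nat.pos_of_ne_zero fun e => ?_
      rw [e, fold_zero, fold_iterate_self] at hz
      exact hz rfl
  have hx := hend x hb
  have hy := hend y (hxy ▸ hb)
  have hreg : (step b)^[j] s(x, y) = s((fold b)^[j] x, (fold b)^[j] y) := by
    cases j with
    | zero => rfl
    | succ j => exact step_iterate_regular hx.1 hy.1 (hmin j (by omega))
  refine ⟨j + 1, by omega, by omega, ?_⟩
  simp only [Function.iterate_succ_apply'] at hj
  rw [Function.iterate_succ_apply', hreg, step_collision hx.2 hy.2 hj,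
    Function.iterate_succ_apply' (fold b)]

theorem fold_iterate_mod_five {k x : ℕ} (t : ℕ) : (fold (5 * k))^[t] x % 5 = 0 ↔ x % 5 = 0 := by
  induction t with
  | zero => rfl
  | succ t ih =>
    rw [Function.iterate_succ_apply', ← ih]
    unfold fold
    omega

theorem fold_mod_two {b x : ℕ} (hb : b % 2 = 0) : fold b x % 2 = 0 := by
  unfold fold
  omega

theorem two_pow_mod_two {n : ℕ} (hn : 0 < n) : 2 ^ n % 2 = 0 := by
  obtain ⟨n, rfl⟩ := Nat.exists_eq_add_of_le' hn
  rw [pow_succ]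
  omega

/-- The pair following a collision, when one of its entries is a multiple of `5`. -/
theorem step_iterate_neighbours {n u : ℕ} (hn : 0 < n) (hu : u % 2 = 0) (hub : u < 5 * 2 ^ n)
    (h : u % 5 = 1 ∨ u % 5 = 4) :
    (step (5 * 2 ^ n))^[n + 1] s(u + 1, u - 1) = s(3 * 2 ^ n, 2 * 2 ^ n - 1) := by
  have h2 := two_pow_mod_two hn
  have key : ∀ x y, x < 5 * 2 ^ n → y < 5 * 2 ^ n → x % 2 = 1 → y % 2 = 1 → x % 5 = 0 →
      (y % 5 = 2 ∨ y % 5 = 3) →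
      (step (5 * 2 ^ n))^[n + 1] s(x, y) = s(3 * 2 ^ n, 2 * 2 ^ n - 1) := by
    intro x y hx hy hx2 hy2 hx5 hy5
    obtain ⟨c, rfl⟩ := Nat.dvd_of_mod_eq_zero hx5
    obtain ⟨r, hr0, hr, hd, hstep⟩ := step_iterate_zero (a := 0) (c := c) (y := y) hn
      (Nat.odd_iff.mpr (by omega)) (by simpa using hx) hy (by omega)
    simp only [pow_zero, mul_one] at hd hr hstep
    obtain rfl : r = 2 := by omega
    rw [add_zero] at hstep
    rw [hstep, Sym2.eq_iff]
    omega
  rcases h with h | h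
  · rw [Sym2.eq_swap]
    exact key _ _ (by omega) (by omega) (by omega) (by omega) (by omega) (by omega)
  · exact key _ _ (by omega) (by omega) (by omega) (by omega) (by omega) (by omega)

/-- The pair following a zero whose partner is even and congruent to `1` modulo `5`. -/
theorem step_iterate_complement_one {n w : ℕ} (hn : 0 < n) (hw : w % 2 = 0) (hwb : w < 5 * 2 ^ n)
    (h : w % 5 = 1) :
    (step (5 * 2 ^ n))^[n + 1] s(5 * 2 ^ n - w, w - 1) = s(5 * 2 ^ n - 2 ^ n, 2 ^ n - 1) := by
  have h2 := two_pow_mod_two hn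
  obtain ⟨c, hc⟩ := Nat.dvd_of_mod_eq_zero (show (w - 1) % 5 = 0 by omega)
  obtain ⟨r, hr0, hr, hd, hstep⟩ := step_iterate_zero (a := 0) (c := c) (y := 5 * 2 ^ n - w) hn
    (Nat.odd_iff.mpr (by omega)) (by rw [add_zero, pow_zero]; omega) (by rw [add_zero]; omega)
    (by omega)
  simp only [pow_zero, mul_one, add_zero] at hd hr hstep
  obtain rfl : r = 1 := by omega
  rw [hc, Sym2.eq_swap, hstep, mul_one]

/-- Both entries are `2` modulo `5`, and their sum `b - 1` is odd, so they collide at the last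
moment. -/
theorem step_iterate_complement_three {n w : ℕ} (hn : 0 < n) (hwb : w < 5 * 2 ^ n)
    (h : w % 5 = 3) :
    (step (5 * 2 ^ n))^[n + 1] s(5 * 2 ^ n - w, w - 1) = s(2 ^ n + 1, 2 ^ n - 1) := by
  have h2 := two_pow_mod_two hn
  exact step_iterate_collision hn (by omega) (by omega) (by omega) (Or.inr (by omega))

theorem step_iterate_zero_of_mod_five {t a c y : ℕ} (ht : 0 < t) (hc : Odd c)
    (hx : 5 * 2 ^ a * c < 5 * 2 ^ (t + a)) (hy : y < 5 * 2 ^ (t + a)) (hy5 : y % 5 ≠ 0) :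
    ∃ w, w % 2 = 0 ∧ w % 5 ≠ 0 ∧ w < 5 * 2 ^ (t + a) ∧
      (step (5 * 2 ^ (t + a)))^[t + 1] s(5 * 2 ^ a * c, y) = s(5 * 2 ^ (t + a) - w, w - 1) := by
  obtain ⟨r, hr0, hr, hd, hstep⟩ := step_iterate_zero ht hc hx hy
    (fun h => hy5 (Nat.mod_eq_zero_of_dvd ((dvd_mul_right 5 _).trans h)))
  refine ⟨2 ^ t * r, ?_, ?_, ?_, hstep⟩
  · rw [Nat.mul_mod, two_pow_mod_two ht, zero_mul, Nat.zero_mod]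
  · have h5 : r % 5 ≠ 0 := by
      intro h
      obtain ⟨s, rfl⟩ := Nat.dvd_of_mod_eq_zero h
      have hy : (5 : ℤ) ∣ y := by
        push_cast at hd
        rcases hd with ⟨q, hq⟩ | ⟨q, hq⟩
        · exact ⟨2 * 2 ^ a * q - 2 ^ a + s, by linear_combination hq⟩
        · exact ⟨2 * 2 ^ a * q - 2 ^ a - s, by linear_combination hq⟩
      omega
    intro h
    have := (Nat.Prime.dvd_mul Nat.prime_five).mp (Nat.dvd_of_mod_eq_zero h)
    rcases this with h' | h'
    · have := Nat.Prime.dvd_of_dvd_pow Nat.prime_five h'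
      omega
    · omega
  · calc 2 ^ t * r < 2 ^ t * (5 * 2 ^ a) := Nat.mul_lt_mul_of_pos_left hr (by positivity)
      _ = 5 * 2 ^ (t + a) := by ring

theorem exists_eq_five_mul_two_pow_mul_odd {n x : ℕ} (hx : 0 < x) (hxb : x < 5 * 2 ^ n)
    (h5 : x % 5 = 0) : ∃ t a c, n = t + a ∧ 0 < t ∧ Odd c ∧ x = 5 * 2 ^ a * c := by
  obtain ⟨z, rfl⟩ := Nat.dvd_of_mod_eq_zero h5
  obtain ⟨a, c, hc, rfl⟩ := Nat.exists_eq_two_pow_mul_odd (show z ≠ 0 by omega)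
  have han : a < n := by
    have h1 : 2 ^ a ≤ 2 ^ a * c := Nat.le_mul_of_pos_right _ hc.pos
    exact (Nat.pow_lt_pow_iff_right (by omega : 1 < 2)).mp (by omega)
  exact ⟨n - a, a, c, by omega, by omega, hc, by ring⟩

/-- The pair obtained from a zero whose partner is a multiple of `5`. -/
theorem step_iterate_complement_zero {t a c : ℕ} (ht : 0 < t) (hc : Odd c)
    (hx : 5 * 2 ^ a * c < 5 * 2 ^ (t + a)) :
    ∃ w, w % 2 = 0 ∧ w % 5 ≠ 0 ∧ w < 5 * 2 ^ (t + a) ∧ (step (5 * 2 ^ (t + a)))^[t + 1]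
      s(5 * 2 ^ (t + a) - 5 * 2 ^ a * c, 5 * 2 ^ a * c - 1) = s(5 * 2 ^ (t + a) - w, w - 1) := by
  -- Complementing in `b` keeps the power of `2`, so the complement vanishes after `t` folds; its
  -- partner is `-1` modulo `5`.
  have e : 5 * 2 ^ (t + a) - 5 * 2 ^ a * c = 5 * 2 ^ a * (2 ^ t - c) := by
    rw [Nat.mul_sub]
    congr 1
    ring
  have hpos : 0 < 5 * 2 ^ a * c := Nat.mul_pos (by positivity) hc.pos
  have hct : c < 2 ^ t := by
    refine Nat.lt_of_mul_lt_mul_left (a := 5 * 2 ^ a) (hx.trans_le (le_of_eq ?_))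
    ring
  have h2 := two_pow_mod_two ht
  have hc2 := Nat.odd_iff.mp hc
  have hodd : Odd (2 ^ t - c) := Nat.odd_iff.mpr (by omega)
  have h5 : (5 * 2 ^ a * c) % 5 = 0 := by rw [mul_assoc]; exact Nat.mul_mod_right 5 _
  rw [e]
  exact step_iterate_zero_of_mod_five ht hodd (by omega) (by omega) (by omega)

/-! ### Upper bound from collision and complement pairs -/

section UpperBound

variable {n A B : ℕ}

theorem step_terminal_fixed (n : ℕ) : step (5 * 2 ^ n) s(3 * 2 ^ n, 2 ^ n) = s(3 * 2 ^ n, 2 ^ n) :=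
  step_fixed (by positivity)

/-- Modulo `5`, `w ≡ 2, 4` puts the entries in different nonzero classes; `w ≡ 0, 1` makes one entry
a multiple of `5` and leads to an even complement; `w ≡ 3` is the hypothesis. -/
theorem reachesWithin_complement (hn : 0 < n) (hB : 0 < B)
    (hW : ∀ w, w % 2 = 0 → w % 5 ≠ 0 → w < 5 * 2 ^ n →
      ReachesWithin (5 * 2 ^ n) s(3 * 2 ^ n, 2 ^ n) s(5 * 2 ^ n - w, w - 1) B)
    (hW3 : ∀ w, w % 5 = 3 → w < 5 * 2 ^ n →
      ReachesWithin (5 * 2 ^ n) s(3 * 2 ^ n, 2 ^ n) s(5 * 2 ^ n - w, w - 1) B)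
    {w : ℕ} (hw0 : 0 < w) (hw : w < 5 * 2 ^ n) :
    ReachesWithin (5 * 2 ^ n) s(3 * 2 ^ n, 2 ^ n) s(5 * 2 ^ n - w, w - 1) (n + 1 + B) := by
  have hq := step_terminal_fixed n
  have h5 : w % 5 = 0 ∨ w % 5 = 1 ∨ w % 5 = 3 ∨ (w % 5 = 2 ∨ w % 5 = 4) := by omega
  rcases h5 with h | h | h | h
  · obtain ⟨t, a, c, rfl, ht, hc, rfl⟩ := exists_eq_five_mul_two_pow_mul_odd hw0 hw h
    obtain ⟨w', h1, h2, h3, hstep⟩ := step_iterate_complement_zero ht hc hw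
    exact ((hW w' h1 h2 h3).of_iterate hq hstep).mono hq (by omega)
  -- For `w = 1` the second entry is already `0`, so the zero rule applies at once.
  · rcases Nat.eq_or_lt_of_le (Nat.succ_le_of_lt hw0) with h1 | h1
    · obtain rfl : w = 1 := h1.symm
      have e : (step (5 * 2 ^ n))^[1] s(5 * 2 ^ n - 1, 1 - 1) =
          s(5 * 2 ^ n - (5 * 2 ^ n - 1), 5 * 2 ^ n - 1 - 1) := step_zero_right (by omega)
      exact ((reachesWithin_of_eq (step_iterate_terminal (by omega) (by omega)
        (by omega))).of_iterate hq e).mono hq (by omega)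
    · obtain ⟨t, a, c, rfl, ht, hc, hx⟩ := exists_eq_five_mul_two_pow_mul_odd
        (show 0 < w - 1 by omega) (show w - 1 < 5 * 2 ^ n by omega) (by omega)
      obtain ⟨w', h1, h2, h3, hstep⟩ := step_iterate_zero_of_mod_five ht hc (hx ▸ by omega)
        (show 5 * 2 ^ (t + a) - w < 5 * 2 ^ (t + a) by omega) (by omega)
      rw [← hx, Sym2.eq_swap] at hstep
      exact ((hW w' h1 h2 h3).of_iterate hq hstep).mono hq (by omega)
  · exact (hW3 w h hw).mono hq (by omega)
  · exact (reachesWithin_of_eq (step_iterate_terminal (by omega) (by omega) (by omega))).mono hq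
      (by omega)

theorem reachesWithin_of_both_mod_five_ne (hn : 0 < n)
    (hC : ∀ u, u % 2 = 0 → u % 5 ≠ 0 → u < 5 * 2 ^ n →
      ReachesWithin (5 * 2 ^ n) s(3 * 2 ^ n, 2 ^ n) s(u + 1, u - 1) A)
    {x y t : ℕ} (ht : 0 < t) (hx : x < 5 * 2 ^ n) (hx5 : x % 5 ≠ 0)
    (hxy : (fold (5 * 2 ^ n))^[t] x = (fold (5 * 2 ^ n))^[t] y) :
    ReachesWithin (5 * 2 ^ n) s(3 * 2 ^ n, 2 ^ n) s(x, y) (A + t) := by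
  have hq := step_terminal_fixed n
  have hmod : ∀ j, (fold (5 * 2 ^ n))^[j] x % 5 ≠ 0 := fun j h =>
    hx5 ((fold_iterate_mod_five j).mp h)
  have hne : (fold (5 * 2 ^ n))^[t] x ≠ 5 * 2 ^ n := fun h => hmod t (by omega)
  obtain ⟨j, hj0, hjt, hstep⟩ := exists_step_iterate_collision ht hne hxy
  have hu5 := hmod j
  have hub := fold_iterate_le hx.le j
  have hu2 : (fold (5 * 2 ^ n))^[j] x % 2 = 0 := by
    obtain ⟨j, rfl⟩ := Nat.exists_eq_add_of_le' hj0
    rw [Function.iterate_succ_apply']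
    have := two_pow_mod_two hn
    exact fold_mod_two (by omega)
  generalize (fold (5 * 2 ^ n))^[j] x = u at *
  rw [show u - 1 + (1 - u) = u - 1 by omega] at hstep
  exact ((hC u hu2 hu5 (by omega)).of_iterate hq hstep).mono hq (by omega)

/-- Two multiples of `5` with the same power of `2` collide before they vanish. -/
theorem reachesWithin_of_same_valuation
    (hC : ∀ u, u % 2 = 0 → u % 5 ≠ 0 → u < 5 * 2 ^ n →
      ReachesWithin (5 * 2 ^ n) s(3 * 2 ^ n, 2 ^ n) s(u + 1, u - 1) A)
    {t a c d : ℕ} (ht : 0 < t) (hn : n = t + a) (hc : Odd c) (hd : Odd d)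
    (hx : 5 * 2 ^ a * c < 5 * 2 ^ n) (hy : 5 * 2 ^ a * d < 5 * 2 ^ n) :
    ReachesWithin (5 * 2 ^ n) s(3 * 2 ^ n, 2 ^ n) s(5 * 2 ^ a * c, 5 * 2 ^ a * d)
      (max (2 * n + 2) (n + A)) := by
  have hq := step_terminal_fixed n
  have hn0 : 0 < n := by omega
  have h2 := two_pow_mod_two hn0
  have h2pos : 0 < 2 ^ n := by positivity
  have hzero : ∀ e, Odd e → 5 * 2 ^ a * e < 5 * 2 ^ n →
      (fold (5 * 2 ^ n))^[t] (5 * 2 ^ a * e) = 0 := by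
    rintro e ⟨f, rfl⟩ he
    subst hn
    rw [fold_iterate_scaled_eq (r := 0) ht he.le (Nat.zero_le _), mul_zero]
    left
    exact ⟨f + 1, by push_cast; ring⟩
  have hx0 := hzero c hc hx
  have hy0 := hzero d hd hy
  have hx5 : (5 * 2 ^ a * c) % 5 = 0 := by rw [mul_assoc]; exact Nat.mul_mod_right 5 _
  obtain ⟨j, hj0, hjt, hstep⟩ := exists_step_iterate_collision ht (by omega) (hx0.trans hy0.symm)
  obtain ⟨s, hs⟩ := Nat.exists_eq_add_of_le' hjt
  have hu5 := (fold_iterate_mod_five (k := 2 ^ n) j).mpr hx5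
  have hub := fold_iterate_le hx.le j
  have hu2 : (fold (5 * 2 ^ n))^[j] (5 * 2 ^ a * c) % 2 = 0 := by
    obtain ⟨j, rfl⟩ := Nat.exists_eq_add_of_le' hj0
    rw [Function.iterate_succ_apply']
    exact fold_mod_two (by omega)
  rw [hs, Function.iterate_add_apply] at hx0
  generalize (fold (5 * 2 ^ n))^[j] (5 * 2 ^ a * c) = u at *
  rcases Nat.eq_zero_or_pos s with rfl | hs0
  -- A collision at `0` gives `s(1, 1)`, which collides again at `b - 2`.
  · obtain rfl : u = 0 := hx0
    have e : fold (5 * 2 ^ n) 1 = 5 * 2 ^ n - 2 := by unfold fold; omega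
    have hstep' : (step (5 * 2 ^ n))^[1] s(0 + 1, 0 - 1 + (1 - 0)) =
        s(5 * 2 ^ n - 1, 5 * 2 ^ n - 3) := by
      rw [Function.iterate_one, step_collision (by omega) (by omega) rfl, zero_add, e, Sym2.eq_iff]
      omega
    exact (((reachesWithin_of_eq (step_iterate_terminal (by omega) (by omega)
      (by omega))).of_iterate hq hstep').of_iterate hq hstep).mono hq (by omega)
  · have hu0 : u ≠ 0 := by
      rintro rfl
      obtain ⟨s, rfl⟩ := Nat.exists_eq_add_of_le' hs0
      rw [Function.iterate_succ_apply, fold_zero, fold_iterate_self] at hx0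
      omega
    have hub' : u ≠ 5 * 2 ^ n := by
      rintro rfl
      rw [fold_iterate_self] at hx0
      omega
    have hn' : n = s + (j + a) := by omega
    -- Since `u` would vanish after `s` folds, its neighbours both arrive at `2 ^ s` then, forcing a
    -- second collision.
    have hcoll : (fold (5 * 2 ^ n))^[s] (u + 1) = (fold (5 * 2 ^ n))^[s] (u - 1) := by
      have hpos : 0 < 2 ^ (j + a) := by positivity
      rw [hn'] at hx0 hub hub' h2 ⊢
      obtain ⟨r, -, hr, hdvd⟩ := fold_iterate_scaled hs0 hub
      rw [hx0] at hr
      obtain rfl : r = 0 := by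
        rcases Nat.mul_eq_zero.mp hr.symm with h | h
        · exact absurd h (by positivity)
        · exact h
      have hdvd' : (10 * 2 ^ (j + a) : ℤ) ∣ u + 5 * 2 ^ (j + a) := by simpa using hdvd
      rw [fold_iterate_scaled_eq (r := 1) hs0 (by omega) (by omega),
        fold_iterate_scaled_eq (r := 1) hs0 (by omega) (by omega)]
      · right
        rw [Nat.cast_sub (by omega)]
        convert hdvd' using 1
        push_cast
        ring
      · left
        convert hdvd' using 1
        push_cast
        ring
    rw [show u - 1 + (1 - u) = u - 1 by omega] at hstep
    exact ((reachesWithin_of_both_mod_five_ne hn0 hC hs0 (by omega) (by omega) hcoll).of_iterate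
      hq hstep).mono hq (by omega)

/-- The entry with more factors `2` vanishes first; its partner is still a multiple of `5`, so its
complement pair produces a second zero. The two phases last at most `n + 2` steps. -/
theorem reachesWithin_of_distinct_valuation
    (hW : ∀ w, w % 2 = 0 → w % 5 ≠ 0 → w < 5 * 2 ^ n →
      ReachesWithin (5 * 2 ^ n) s(3 * 2 ^ n, 2 ^ n) s(5 * 2 ^ n - w, w - 1) B)
    {t a t' a' c d : ℕ} (ht' : 0 < t') (hn : n = t + a) (hn' : n = t' + a')
    (haa : a < a') (hc : Odd c) (hd : Odd d)
    (hx : 5 * 2 ^ a * c < 5 * 2 ^ n) (hy : 5 * 2 ^ a' * d < 5 * 2 ^ n) :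
    ReachesWithin (5 * 2 ^ n) s(3 * 2 ^ n, 2 ^ n) s(5 * 2 ^ a' * d, 5 * 2 ^ a * c)
      (n + 2 + B) := by
  have hq := step_terminal_fixed n
  obtain ⟨i, rfl⟩ := Nat.exists_eq_add_of_lt haa
  have h0 : (5 * 2 ^ a : ℤ) ≠ 0 := by positivity
  have hndvd : ¬ 5 * 2 ^ (a + i + 1) ∣ 5 * 2 ^ a * c := by
    rintro ⟨z, hz⟩
    have : c = 2 * (2 ^ i * z) := by
      apply Nat.eq_of_mul_eq_mul_left (show 0 < 5 * 2 ^ a by positivity)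
      rw [hz]
      ring
    have hc2 := Nat.odd_iff.mp hc
    omega
  obtain ⟨r, hr0, hr, hdvd, hstep⟩ :=
    step_iterate_zero ht' hd (hn' ▸ hy) (hn' ▸ hx) hndvd
  obtain ⟨e, he, rfl⟩ : ∃ e, Odd e ∧ r = 5 * 2 ^ a * e := by
    have hr' : ∃ z : ℤ, Odd z ∧ (r : ℤ) = 5 * 2 ^ a * z := by
      obtain ⟨f, rfl⟩ := hc
      push_cast at hdvd
      rcases hdvd with ⟨q, hq⟩ | ⟨q, hq⟩
      · exact ⟨2 * f + 1 + 2 ^ (i + 1) - 2 ^ (i + 2) * q,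
          ⟨f + 2 ^ i - 2 ^ (i + 1) * q, by ring⟩, by linear_combination -hq⟩
      · exact ⟨-(2 * f + 1 + 2 ^ (i + 1) - 2 ^ (i + 2) * q),
          ⟨-f - 1 - 2 ^ i + 2 ^ (i + 1) * q, by ring⟩, by linear_combination hq⟩
    obtain ⟨z, hz, hrz⟩ := hr'
    have hz0 : 0 ≤ z := by
      by_contra! hneg
      have : (5 * 2 ^ a : ℤ) * z < 0 := mul_neg_of_pos_of_neg (by positivity) hneg
      omega
    lift z to ℕ using hz0
    exact ⟨z, by exact_mod_cast hz, by exact_mod_cast hrz⟩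
  have hw : 2 ^ t' * (5 * 2 ^ a * e) = 5 * 2 ^ (t' + a) * e := by ring
  have hn'' : t' + (a + i + 1) = (i + 1) + (t' + a) := by ring
  have hlt : 5 * 2 ^ (t' + a) * e < 5 * 2 ^ ((i + 1) + (t' + a)) := by
    rw [← hw, ← hn'']
    calc 2 ^ t' * (5 * 2 ^ a * e) < 2 ^ t' * (5 * 2 ^ (a + i + 1)) :=
          Nat.mul_lt_mul_of_pos_left hr (by positivity)
      _ = 5 * 2 ^ (t' + (a + i + 1)) := by ring
  obtain ⟨w, h1, h2, h3, hstep'⟩ := step_iterate_complement_zero (by omega) he hlt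
  rw [← hn'', ← hn'] at h3 hstep'
  rw [← hn', hw] at hstep
  exact (((hW w h1 h2 h3).of_iterate hq hstep').of_iterate hq hstep).mono hq (by omega)

theorem reachesWithin_all {M : ℕ} (hn : 0 < n) (hB : 0 < B)
    (hC : ∀ u, u % 2 = 0 → u % 5 ≠ 0 → u < 5 * 2 ^ n →
      ReachesWithin (5 * 2 ^ n) s(3 * 2 ^ n, 2 ^ n) s(u + 1, u - 1) A)
    (hW : ∀ w, w % 2 = 0 → w % 5 ≠ 0 → w < 5 * 2 ^ n →
      ReachesWithin (5 * 2 ^ n) s(3 * 2 ^ n, 2 ^ n) s(5 * 2 ^ n - w, w - 1) B)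
    (hW3 : ∀ w, w % 5 = 3 → w < 5 * 2 ^ n →
      ReachesWithin (5 * 2 ^ n) s(3 * 2 ^ n, 2 ^ n) s(5 * 2 ^ n - w, w - 1) B)
    (hMA : n + 1 + A ≤ M) (hMB : n + 2 + B ≤ M) (hM : 2 * n + 2 ≤ M)
    (p : Sym2 ℕ) (hp : Below (5 * 2 ^ n) p) :
    ReachesWithin (5 * 2 ^ n) s(3 * 2 ^ n, 2 ^ n) p M := by
  have hq := step_terminal_fixed n
  induction p with | _ x y
  rw [below_mk] at hp
  obtain ⟨hx, hy⟩ := hp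
  have hzero : ∀ w, 0 < w → w < 5 * 2 ^ n →
      ReachesWithin (5 * 2 ^ n) s(3 * 2 ^ n, 2 ^ n) s(w, 0) M := fun w hw0 hw =>
    ((reachesWithin_complement hn hB hW hW3 hw0 hw).of_iterate hq
      (d := 1) (step_zero_right hw0)).mono hq (by omega)
  have hmixed : ∀ x y, 0 < x → x < 5 * 2 ^ n → y < 5 * 2 ^ n → x % 5 = 0 → y % 5 ≠ 0 →
      ReachesWithin (5 * 2 ^ n) s(3 * 2 ^ n, 2 ^ n) s(x, y) M := by
    intro x y hx0 hx hy hx5 hy5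
    obtain ⟨t, a, c, rfl, ht, hc, rfl⟩ := exists_eq_five_mul_two_pow_mul_odd hx0 hx hx5
    obtain ⟨w, h1, h2, h3, hstep⟩ := step_iterate_zero_of_mod_five ht hc hx hy hy5
    exact ((hW w h1 h2 h3).of_iterate hq hstep).mono hq (by omega)
  rcases Nat.eq_zero_or_pos x with rfl | hx0
  · rcases Nat.eq_zero_or_pos y with rfl | hy0
    · exact reachesWithin_of_cycle one_pos (step_zero_zero _) hq
    · rw [show s(0, y) = s(y, 0) from Sym2.eq_swap]
      exact hzero y hy0 hy
  rcases Nat.eq_zero_or_pos y with rfl | hy0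
  · exact hzero x hx0 hx
  by_cases hx5 : x % 5 = 0 <;> by_cases hy5 : y % 5 = 0
  · obtain ⟨t, a, c, hta, ht, hc, rfl⟩ := exists_eq_five_mul_two_pow_mul_odd hx0 hx hx5
    obtain ⟨t', a', d, hta', ht', hd, rfl⟩ := exists_eq_five_mul_two_pow_mul_odd hy0 hy hy5
    rcases lt_trichotomy a a' with h | rfl | h
    · rw [show s(5 * 2 ^ a * c, 5 * 2 ^ a' * d) = s(5 * 2 ^ a' * d, 5 * 2 ^ a * c)
        from Sym2.eq_swap]
      exact (reachesWithin_of_distinct_valuation hW ht' hta hta' h hc hd hx hy).mono hq hMB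
    · exact (reachesWithin_of_same_valuation hC ht hta hc hd hx hy).mono hq (by omega)
    · exact (reachesWithin_of_distinct_valuation hW ht hta' hta h hd hc hy hx).mono hq hMB
  · exact hmixed x y hx0 hx hy hx5 hy5
  · rw [show s(x, y) = s(y, x) from Sym2.eq_swap]
    exact hmixed y x hy0 hy hx hy5 hx5
  · have hx' : (x % 5 = 1 ∨ x % 5 = 4) ∨ (x % 5 = 2 ∨ x % 5 = 3) := by omega
    have hy' : (y % 5 = 1 ∨ y % 5 = 4) ∨ (y % 5 = 2 ∨ y % 5 = 3) := by omega
    obtain ⟨-, x1, x2⟩ := fold_iterate_terminal hx.le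
    obtain ⟨-, y1, y2⟩ := fold_iterate_terminal hy.le
    rcases hx' with h1 | h1 <;> rcases hy' with h2 | h2
    · exact (reachesWithin_of_both_mod_five_ne hn hC n.succ_pos hx hx5
        ((x1 h1).trans (y1 h2).symm)).mono hq (by omega)
    · exact (reachesWithin_of_eq (step_iterate_terminal hx.le hy.le (Or.inl ⟨h1, h2⟩))).mono hq
        (by omega)
    · exact (reachesWithin_of_eq (step_iterate_terminal hx.le hy.le (Or.inr ⟨h1, h2⟩))).mono hq
        (by omega)
    · exact (reachesWithin_of_both_mod_five_ne hn hC n.succ_pos hx hx5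
        ((x2 h1).trans (y2 h2).symm)).mono hq (by omega)

end UpperBound

/-! ### Reduction to three critical pairs -/

theorem iterate_trans {α : Type*} {f : α → α} {x y z : α} {i j : ℕ} (h : f^[i] x = y)
    (h' : f^[j] y = z) : f^[j + i] x = z := by
  rw [Function.iterate_add_apply, h, h']

theorem reachesWithin_neighbours {n F : ℕ} (hn : 0 < n)
    (hZ : ReachesWithin (5 * 2 ^ n) s(3 * 2 ^ n, 2 ^ n) s(3 * 2 ^ n, 2 * 2 ^ n - 1) F)
    (u : ℕ) (hu2 : u % 2 = 0) (hu5 : u % 5 ≠ 0) (hu : u < 5 * 2 ^ n) :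
    ReachesWithin (5 * 2 ^ n) s(3 * 2 ^ n, 2 ^ n) s(u + 1, u - 1) (F + (n + 1)) := by
  have hq := step_terminal_fixed n
  have h2 := two_pow_mod_two hn
  have h5 : (u % 5 = 2 ∨ u % 5 = 3) ∨ (u % 5 = 1 ∨ u % 5 = 4) := by omega
  rcases h5 with h | h
  · exact (reachesWithin_of_eq (step_iterate_terminal (by omega) (by omega) (by omega))).mono hq
      (by omega)
  · exact hZ.of_iterate hq (step_iterate_neighbours hn hu2 hu h)

theorem reachesWithin_complement_three {n E : ℕ} (hn : 0 < n)
    (hCk : ReachesWithin (5 * 2 ^ n) s(3 * 2 ^ n, 2 ^ n) s(2 ^ n + 1, 2 ^ n - 1) E)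
    (w : ℕ) (hw5 : w % 5 = 3) (hw : w < 5 * 2 ^ n) :
    ReachesWithin (5 * 2 ^ n) s(3 * 2 ^ n, 2 ^ n) s(5 * 2 ^ n - w, w - 1) (E + (n + 1)) :=
  hCk.of_iterate (step_terminal_fixed n) (step_iterate_complement_three hn hw hw5)

theorem reachesWithin_complement_even {n E : ℕ} (hn : 0 < n)
    (hCk : ReachesWithin (5 * 2 ^ n) s(3 * 2 ^ n, 2 ^ n) s(2 ^ n + 1, 2 ^ n - 1) E)
    (hWk : ReachesWithin (5 * 2 ^ n) s(3 * 2 ^ n, 2 ^ n) s(5 * 2 ^ n - 2 ^ n, 2 ^ n - 1) E)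
    (w : ℕ) (hw2 : w % 2 = 0) (hw5 : w % 5 ≠ 0) (hw : w < 5 * 2 ^ n) :
    ReachesWithin (5 * 2 ^ n) s(3 * 2 ^ n, 2 ^ n) s(5 * 2 ^ n - w, w - 1) (E + (n + 1)) := by
  have hq := step_terminal_fixed n
  have h5 : w % 5 = 1 ∨ w % 5 = 3 ∨ (w % 5 = 2 ∨ w % 5 = 4) := by omega
  rcases h5 with h | h | h
  · exact hWk.of_iterate hq (step_iterate_complement_one hn hw2 hw h)
  · exact reachesWithin_complement_three hn hCk w h hw
  · exact (reachesWithin_of_eq (step_iterate_terminal (by omega) (by omega) (by omega))).mono hq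
      (by omega)

/-- The largest distance is determined by the orbits of three particular pairs, together with an
orbit that attains the bound. -/
theorem isMaxDistance_five_mul_two_pow {n E F M d x y : ℕ} {p : Sym2 ℕ} (hn : 0 < n)
    (hCk : ReachesWithin (5 * 2 ^ n) s(3 * 2 ^ n, 2 ^ n) s(2 ^ n + 1, 2 ^ n - 1) E)
    (hWk : ReachesWithin (5 * 2 ^ n) s(3 * 2 ^ n, 2 ^ n) s(5 * 2 ^ n - 2 ^ n, 2 ^ n - 1) E)
    (hZ : ReachesWithin (5 * 2 ^ n) s(3 * 2 ^ n, 2 ^ n) s(3 * 2 ^ n, 2 * 2 ^ n - 1) F)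
    (hF : F + (2 * n + 2) ≤ M) (hE : E + (2 * n + 3) ≤ M)
    (hp : Below (5 * 2 ^ n) p) (hM : M = (n + 1) + d)
    (hd : (step (5 * 2 ^ n))^[d] p = s(x, y)) (hx : x ≤ 5 * 2 ^ n) (hy : y ≤ 5 * 2 ^ n)
    (hodd : x % 2 = 1)
    (h : ((x % 5 = 1 ∨ x % 5 = 4) ∧ (y % 5 = 2 ∨ y % 5 = 3)) ∨
      ((x % 5 = 2 ∨ x % 5 = 3) ∧ (y % 5 = 1 ∨ y % 5 = 4))) :
    IsMaxDistance (5 * 2 ^ n) (M + 1) := by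
  refine isMaxDistance_five_mul (by positivity) M (by omega) (reachesWithin_all hn (by omega)
    (reachesWithin_neighbours hn hZ) (reachesWithin_complement_even hn hCk hWk)
    (reachesWithin_complement_three hn hCk) (by omega) (by omega) (by omega)) ⟨p, hp, ?_, ?_⟩
  · rw [hM]
    exact iterate_trans hd (step_iterate_terminal hx hy h)
  · rw [show M - 1 = n + d by omega, iterate_trans hd rfl]
    exact step_iterate_ne_terminal hn hx hy hodd h

/-! ### Extremal orbits by residue of n modulo 4 -/

theorem two_pow_mod_five (n : ℕ) : 2 ^ n % 5 = 2 ^ (n % 4) % 5 := by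
  conv_lhs => rw [← Nat.div_add_mod n 4, pow_add, pow_mul, Nat.mul_mod, Nat.pow_mod]
  norm_num

/-- From `s(b / 2, b / 2 + 5)` in base `b = 10 * 2 ^ m`. -/
theorem step_iterate_half {m : ℕ} (hm : 0 < m) :
    (step (5 * 2 ^ (m + 1)))^[m + 3] s(5 * 2 ^ m + 5, 5 * 2 ^ m) =
      s(5 * 2 ^ (m + 1) - 2 ^ m, 2 ^ m - 1) := by
  have h2 := two_pow_mod_two hm
  have hpos : 0 < 2 ^ m := by positivity
  have e1 : fold (5 * 2 ^ (m + 1)) (5 * 2 ^ m + 5) = 10 := by unfold fold; omega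
  have e2 : fold (5 * 2 ^ (m + 1)) (5 * 2 ^ m) = 0 := by unfold fold; omega
  obtain ⟨r, hr0, hr, hd, hstep⟩ := step_iterate_zero (a := 1) (c := 2 ^ m - 1) (y := 9) hm
    (Nat.odd_iff.mpr (by omega)) (by omega) (by omega) (by omega)
  norm_num at hd hr
  obtain rfl : r = 1 := by omega
  -- The pair becomes `s(10, 0)`, then `s(b - 10, 9)`; both starting entries are multiples of `5`,
  -- with different powers of `2`.
  have hstart : (step (5 * 2 ^ (m + 1)))^[2] s(5 * 2 ^ m + 5, 5 * 2 ^ m) =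
      s(5 * 2 ^ 1 * (2 ^ m - 1), 9) := by
    rw [Function.iterate_succ_apply, Function.iterate_one,
      step_regular (by omega) (by omega) (by omega), e1, e2, step_zero_right (by omega)]
    congr 2
    omega
  rw [mul_one] at hstep
  exact iterate_trans (j := m + 1) hstart hstep

/-- From `s(b / 4 - 5, b / 4)` in base `b = 20 * 2 ^ m`. -/
theorem step_iterate_quarter {m : ℕ} (hm : 0 < m) :
    (step (5 * 2 ^ (m + 2)))^[m + 4] s(5 * 2 ^ m - 5, 5 * 2 ^ m) =
      s(5 * 2 ^ (m + 2) - 2 ^ m, 2 ^ m - 1) := by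
  have h2 := two_pow_mod_two hm
  have hpos : 0 < 2 ^ m := by positivity
  have h4 : 2 ^ (m + 2) = 4 * 2 ^ m := by ring
  have e1 : fold (5 * 2 ^ (m + 2)) (5 * 2 ^ m - 5) = 10 * 2 ^ m + 10 := by unfold fold; omega
  have e2 : fold (5 * 2 ^ (m + 2)) (5 * 2 ^ m) = 10 * 2 ^ m := by unfold fold; omega
  have e3 : fold (5 * 2 ^ (m + 2)) (10 * 2 ^ m + 10) = 20 := by unfold fold; omega
  have e4 : fold (5 * 2 ^ (m + 2)) (10 * 2 ^ m) = 0 := by unfold fold; omega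
  obtain ⟨r, hr0, hr, hd, hstep⟩ := step_iterate_zero (a := 2) (c := 2 ^ m - 1) (y := 19) hm
    (Nat.odd_iff.mpr (by omega)) (by omega) (by omega) (by omega)
  norm_num at hd hr
  obtain rfl : r = 1 := by omega
  have hstart : (step (5 * 2 ^ (m + 2)))^[3] s(5 * 2 ^ m - 5, 5 * 2 ^ m) =
      s(5 * 2 ^ 2 * (2 ^ m - 1), 19) := by
    rw [Function.iterate_succ_apply, Function.iterate_succ_apply, Function.iterate_one,
      step_regular (by omega) (by omega) (by omega), e1, e2,
      step_regular (by omega) (by omega) (by omega), e3, e4, step_zero_right (by omega)]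
    congr 2
    omega
  rw [mul_one] at hstep
  exact iterate_trans (j := m + 1) hstart hstep

/-- Now `k = 2 ^ n ≡ 1` modulo `5`: `s(b - k, k - 1)` is periodic. The half orbit, with `2 ^ (n - 1)
≡ 3`, passes through `s(k + 1, k - 1)` and `s(3 * k, 2 * k - 1)`. -/
theorem isMaxDistance_of_mod_four_eq_zero {n : ℕ} (hn : 3 ≤ n) (h4 : n % 4 = 0) :
    IsMaxDistance (5 * 2 ^ n) (4 * n + 6) := by
  obtain ⟨m, rfl⟩ := Nat.exists_eq_add_of_le' (show 1 ≤ n by omega)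
  have hm : 0 < m := by omega
  have hn0 : 0 < m + 1 := by omega
  have hq := step_terminal_fixed (m + 1)
  have h2 := two_pow_mod_two hn0
  have hk : 2 ^ (m + 1) % 5 = 1 := by norm_num [two_pow_mod_five, h4]
  have hpos : 0 < 2 ^ m := by positivity
  have hlt : 1 < 2 ^ m := Nat.one_lt_two_pow hm.ne'
  have hZ := step_iterate_terminal (n := m + 1) (x := 3 * 2 ^ (m + 1)) (y := 2 * 2 ^ (m + 1) - 1)
    (by omega) (by omega) (by omega)
  have hC := step_iterate_neighbours hn0 h2 (by omega) (Or.inl hk)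
  have hW := step_iterate_complement_one hn0 h2 (by omega) hk
  have hH := step_iterate_complement_three (n := m + 1) (w := 2 ^ m) hn0 (by omega) (by omega)
  refine isMaxDistance_five_mul_two_pow (E := 2 * (m + 1) + 2) (F := m + 2) hn0
    (((reachesWithin_of_eq hZ).of_iterate hq hC).mono hq (by omega))
    (reachesWithin_of_cycle (by omega) hW hq) (reachesWithin_of_eq hZ) (by omega) (by omega)
    (p := s(5 * 2 ^ m + 5, 5 * 2 ^ m)) (below_mk.mpr (by omega)) ?_
    ((iterate_trans (iterate_trans (step_iterate_half hm) hH) hC).trans Sym2.eq_swap)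
    (by omega) (by omega) (by omega) (by omega)
  omega

/-- All three critical pairs have different nonzero classes and arrive in `n + 1` steps. -/
theorem isMaxDistance_of_mod_four_eq_one {n : ℕ} (hn : 3 ≤ n) (h4 : n % 4 = 1) :
    IsMaxDistance (5 * 2 ^ n) (3 * n + 5) := by
  obtain ⟨m, rfl⟩ := Nat.exists_eq_add_of_le' (show 1 ≤ n by omega)
  have hm : 0 < m := by omega
  have hn0 : 0 < m + 1 := by omega
  have hq := step_terminal_fixed (m + 1)
  have h2 := two_pow_mod_two hn0
  have hk : 2 ^ (m + 1) % 5 = 2 := by norm_num [two_pow_mod_five, h4]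
  have hlt : 1 < 2 ^ m := Nat.one_lt_two_pow hm.ne'
  have hH := step_iterate_complement_one (n := m + 1) (w := 2 ^ m) hn0 (two_pow_mod_two hm)
    (by omega) (by omega)
  refine isMaxDistance_five_mul_two_pow (E := m + 2) (F := m + 2) hn0
    (reachesWithin_of_eq (step_iterate_terminal (by omega) (by omega) (by omega)))
    (reachesWithin_of_eq (step_iterate_terminal (by omega) (by omega) (by omega)))
    (reachesWithin_of_eq (step_iterate_terminal (by omega) (by omega) (by omega)))
    (by omega) (by omega) (p := s(5 * 2 ^ m + 5, 5 * 2 ^ m)) (below_mk.mpr (by omega)) ?_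
    ((iterate_trans (step_iterate_half hm) hH).trans Sym2.eq_swap)
    (by omega) (by omega) (by omega) (by omega)
  omega

/-- Here `s(k + 1, k - 1)` and `s(3 * k, 2 * k - 1)` form a cycle. The quarter start is used because
`2 ^ (n - 2) ≡ 1` modulo `5`, leading to `s(b - k, k - 1)`. -/
theorem isMaxDistance_of_mod_four_eq_two {n : ℕ} (hn : 3 ≤ n) (h4 : n % 4 = 2) :
    IsMaxDistance (5 * 2 ^ n) (3 * n + 5) := by
  obtain ⟨m, rfl⟩ := Nat.exists_eq_add_of_le' (show 2 ≤ n by omega)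
  have hm : 0 < m := by omega
  have hn0 : 0 < m + 2 := by omega
  have hq := step_terminal_fixed (m + 2)
  have h2 := two_pow_mod_two hn0
  have h4m : 2 ^ (m + 2) = 4 * 2 ^ m := by ring
  have hk : 2 ^ (m + 2) % 5 = 4 := by norm_num [two_pow_mod_five, h4]
  have hlt : 1 < 2 ^ m := Nat.one_lt_two_pow hm.ne'
  have hC := step_iterate_neighbours hn0 h2 (by omega) (Or.inr hk)
  have hZ := step_iterate_collision (n := m + 2) (x := 3 * 2 ^ (m + 2))
    (y := 2 * 2 ^ (m + 2) - 1) (u := 2 ^ (m + 2)) hn0 (by omega) (by omega) (by omega)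
    (Or.inr (by omega))
  have hH := step_iterate_complement_one (n := m + 2) (w := 2 ^ m) hn0 (two_pow_mod_two hm)
    (by omega) (by omega)
  refine isMaxDistance_five_mul_two_pow (E := m + 3) (F := 0) hn0
    (reachesWithin_of_cycle (by omega) (iterate_trans hC hZ) hq)
    (reachesWithin_of_eq (step_iterate_terminal (by omega) (by omega) (by omega)))
    (reachesWithin_of_cycle (by omega) (iterate_trans hZ hC) hq)
    (by omega) (by omega) (p := s(5 * 2 ^ m - 5, 5 * 2 ^ m)) (below_mk.mpr (by omega)) ?_
    ((iterate_trans (step_iterate_quarter hm) hH).trans Sym2.eq_swap)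
    (by omega) (by omega) (by omega) (by omega)
  omega

/-- The critical pairs form one chain, `s(3 * k, 2 * k - 1)` to `s(b - k, k - 1)` to `s(k + 1, k -
1)` to the target. The collision of `1` and `4` at `3 * k ≡ 4` feeds into its start, giving five
blocks of `n + 1` steps. -/
theorem isMaxDistance_of_mod_four_eq_three {n : ℕ} (hn : 3 ≤ n) (h4 : n % 4 = 3) :
    IsMaxDistance (5 * 2 ^ n) (5 * n + 6) := by
  have hn0 : 0 < n := by omega
  have hq := step_terminal_fixed n
  have h2 := two_pow_mod_two hn0
  have hk : 2 ^ n % 5 = 3 := by norm_num [two_pow_mod_five, h4]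
  have hpos : 0 < 2 ^ n := by positivity
  have hC := step_iterate_terminal (n := n) (x := 2 ^ n + 1) (y := 2 ^ n - 1)
    (by omega) (by omega) (by omega)
  have hW := step_iterate_complement_three (n := n) (w := 2 ^ n) hn0 (by omega) hk
  have hZ : (step (5 * 2 ^ n))^[n + 1] s(3 * 2 ^ n, 2 * 2 ^ n - 1) =
      s(5 * 2 ^ n - 2 ^ n, 2 ^ n - 1) := by
    obtain ⟨c, hc⟩ := Nat.dvd_of_mod_eq_zero (show (2 * 2 ^ n - 1) % 5 = 0 by omega)
    obtain ⟨r, hr0, hr, hd, hstep⟩ := step_iterate_zero (a := 0) (c := c) (y := 3 * 2 ^ n) hn0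
      (Nat.odd_iff.mpr (by omega)) (by rw [add_zero, pow_zero]; omega) (by rw [add_zero]; omega)
      (by omega)
    simp only [pow_zero, mul_one, add_zero] at hd hr hstep
    obtain rfl : r = 1 := by omega
    rw [hc, Sym2.eq_swap, hstep, mul_one]
  have hN := step_iterate_neighbours (u := 3 * 2 ^ n) hn0 (by omega) (by omega)
    (Or.inr (by omega))
  have hS := step_iterate_collision (n := n) (x := 1) (y := 4) hn0 (by omega) (by omega) (by omega)
    (Or.inl ⟨Or.inl rfl, Or.inr rfl, rfl⟩)
  have hWr := (reachesWithin_of_eq hC).of_iterate hq hW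
  refine isMaxDistance_five_mul_two_pow (E := 2 * n + 2) (F := 3 * n + 3) hn0
    ((reachesWithin_of_eq hC).mono hq (by omega)) (hWr.mono hq (by omega))
    ((hWr.of_iterate hq hZ).mono hq (by omega)) (by omega) (by omega) (p := s(1, 4))
    (below_mk.mpr (by omega)) ?_
    (iterate_trans (iterate_trans (iterate_trans hS hN) hZ) hW)
    (by omega) (by omega) (by omega) (by omega)
  omega

theorem theorem1 :
    (IsMaxDistance 2 1 ∧ IsMaxDistance 4 3 ∧ IsMaxDistance 5 4 ∧ IsMaxDistance 10 7 ∧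
      IsMaxDistance 20 10) ∧
    (∀ m n : ℕ, Odd m → 1 < m → IsMaxDistance (5 * m * 2 ^ n) (n + 2)) ∧
    (∀ n : ℕ, 3 ≤ n →
      (n ≡ 0 [MOD 4] → IsMaxDistance (5 * 2 ^ n) (4 * n + 6)) ∧
      (n ≡ 1 [MOD 4] → IsMaxDistance (5 * 2 ^ n) (3 * n + 5)) ∧
      (n ≡ 2 [MOD 4] → IsMaxDistance (5 * 2 ^ n) (3 * n + 5)) ∧
      (n ≡ 3 [MOD 4] → IsMaxDistance (5 * 2 ^ n) (5 * n + 6))) :=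
  ⟨⟨isMaxDistance_two, isMaxDistance_four, isMaxDistance_five, isMaxDistance_ten,
    isMaxDistance_twenty⟩, fun _ _ hm hm1 => isMaxDistance_of_odd_factor hm hm1,
    fun _ hn => ⟨fun h => isMaxDistance_of_mod_four_eq_zero hn h,
      fun h => isMaxDistance_of_mod_four_eq_one hn h,
      fun h => isMaxDistance_of_mod_four_eq_two hn h,
      fun h => isMaxDistance_of_mod_four_eq_three hn h⟩⟩
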